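/- For a function $\psi:\mathbb{N}_{\ge 1}\to(0,\infty)$ let $\lambda(\psi)=-\lim_{q\to\infty}\frac{\log\psi(q)}{\log q}$, when this limit exists in $\mathbb{R}$. For an irrational $\theta$, its Diophantine exponent is the infimum of the real numbers $g$ such that $|\theta-p/q|\le q^{-g}$ has only finitely many solutions in integers $p,q$ with $q\geq 1$. For $0<\psi_2\le\psi_1$ and $\theta\in\mathbb{R}$, let $\mathrm{Tight}(\psi_1,\psi_2,\theta)$ be the set of real numbers $x$ such that $$\Big|x-\frac{r-\theta}{q}\Big|\le\psi_1(q)$$ holds for infinitely many pairs $(r,q)$ of relatively prime integers with $q\ge1$, while for every $c>0$ $$\Big|x-\frac{r-\theta}{q}\Big|\le\psi_1(q)-c\,\psi_2(q)$$ holds for only finitely many such pairs. The Fourier dimension $\dim_F E$ of a set $E\subseteq\mathbb{R}$ is the supremum of the $s\in[0,1]$ for which there are a Borel probability measure $\mu$, concentrated on a compact subset of $E$, and a constant $C$ such that $\big|\int e^{-2\pi i\xi x}\,d\mu(x)\big|\le C|\xi|^{-s/2}$ for all real $\xi\ne0$ (with $\dim_F\emptyset=0$). **Theorem.** Let $\theta\in[0,1)$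 be either $0$ or an irrational number with finite Diophantine exponent $\gamma$, taking $\gamma=1$ if $\theta=0$. Let $\psi_1,\psi_2:\mathbb{N}_{\ge1}\to(0,\infty)$ be decreasing (not necessarily strictly) functions with $\psi_2(q)\le\psi_1(q)$ for all $q$ and such that $\psi_1-\psi_2$ is decreasing (not necessarily strictly). Suppose that the orders $\tau_1=\lambda(\psi_1)$ and $\tau_2=\lambda(\psi_2)$ exist and that $\tau_1>1$, and let $\beta=\gamma^{-2}(\tau_1-1)^2$. If $\beta>\tau_2$, then $\dim_F\mathrm{Tight}(\psi_1,\psi_2,\theta)>0$; moreover, $$\dim_F\mathrm{Tight}(\psi_1,\psi_2,\theta)\ \ge\ \frac{2(\beta-\tau_2)}{\tau_2(\beta-1)}.$$ -/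

import Mathlib

open MeasureTheory Filter Topology

noncomputable section

/-- The Fourier transform `ξ ↦ ∫ e^{-2πiξx} dμ(x)` of a measure on the line. -/
def measureFourier (μ : Measure ℝ) (ξ : ℝ) : ℂ :=
  ∫ x, Complex.exp (-(2 * Real.pi * ξ * x : ℝ) * Complex.I) ∂μ

/-- `E` carries a Borel probability measure, concentrated on a compact subset of `E`, whose
Fourier transform is `O(|ξ|^{-s/2})`. -/
def SupportsFourierDecay (E : Set ℝ) (s : ℝ) : Prop :=
  ∃ (μ : Measure ℝ) (K : Set ℝ) (C : ℝ), IsProbabilityMeasure μ ∧ IsCompact K ∧ K ⊆ E ∧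
    μ Kᶜ = 0 ∧ ∀ ξ : ℝ, ξ ≠ 0 → ‖measureFourier μ ξ‖ ≤ C * |ξ| ^ (-s / 2)

/-- The Fourier dimension of a subset of the line. The set of exponents is bounded by `1`, and it
contains `0` as soon as `E` is nonempty; the empty set gets dimension `0`. -/
def fourierDim (E : Set ℝ) : ℝ :=
  sSup {s : ℝ | 0 ≤ s ∧ s ≤ 1 ∧ SupportsFourierDecay E s}

/-- `γ` is the (finite) Diophantine approximation exponent of `θ`: the infimum of the real `g` for
which `|θ - p/q| ≤ q^{-g}` has only finitely many solutions in integers `p`, `q` with `q > 0`.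
As a greatest lower bound in `ℝ`, it exists only if there is such a `g`. -/
def HasDiophantineExponent (θ γ : ℝ) : Prop :=
  IsGLB {g : ℝ | {pq : ℤ × ℕ | 0 < pq.2 ∧
    |θ - (pq.1 : ℝ) / (pq.2 : ℝ)| ≤ (pq.2 : ℝ) ^ (-g)}.Finite} γ

/-- The order `λ(ψ) = - lim log ψ(q) / log q` exists and equals `τ`. -/
def HasOrder (ψ : ℕ → ℝ) (τ : ℝ) : Prop :=
  Tendsto (fun q : ℕ => -(Real.log (ψ q) / Real.log (q : ℝ))) atTop (𝓝 τ)

/-- The pairs `(r, q)` of relatively prime integers, `q > 0`, with `|x - (r - θ)/q| ≤ φ(q)`. -/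
def approxPairs (φ : ℕ → ℝ) (θ x : ℝ) : Set (ℤ × ℕ) :=
  {rq | 0 < rq.2 ∧ IsCoprime rq.1 (rq.2 : ℤ) ∧
    |x - ((rq.1 : ℝ) - θ) / (rq.2 : ℝ)| ≤ φ rq.2}

/-- The set of real numbers of tight approximation order. -/
def Tight (ψ₁ ψ₂ : ℕ → ℝ) (θ : ℝ) : Set ℝ :=
  {x | (approxPairs ψ₁ θ x).Infinite ∧
    ∀ c : ℝ, 0 < c → (approxPairs (fun q => ψ₁ q - c * ψ₂ q) θ x).Finite}

end

/-! ### Smooth densities and periodic kernels with rapid Fourier decay. -/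

section

open scoped SchwartzMap FourierTransform

/-! The measure is a weak limit of normalized densities `ρ₀ F₀ F₁ ⋯ F_k`. Each multiplier averages,
over the primes q in (N^(1-ε), N] with N = N_{k+1}, a nonnegative 1/q-periodic bump of mean one. The
bump lives where x - (n - θ)/q lies in [ψ₁(q) - ψ₂(q)/(k+1), ψ₁(q)]. So every point of the support
has, at each level, an approximation that barely satisfies the inequality (`approx_of_near_int`).

Tightness also needs that no other pair interferes. Distinct shifted reduced fractions with
denominators q ≤ q' are ≫ q'^(-g)/q apart for any g > γ (`exists_separation`). Hence a fraction
chosen at level N is farther than ψ₁(q) + ψ₁(q') from all others with N^(1/b) ≤ q' < N^b, for b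
slightly below (τ₁ - 1)/γ = √β (`eventually_window`). With N_{k+1} = N_k^(b²) these windows tile all
large denominators, and `mem_tight_of_windows` applies.

For the Fourier decay, let m = N_k^t and M = N_{k+1}^t, with t slightly above τ₂, be consecutive
frequency scales. The multiplier perturbs the transform only through frequencies jq with j ≠ 0. A
nonzero integer has few prime divisors in the range (`card_prime_divisors_le`), so averaging gains
nearly 1/N, against a convolution cost M^a m^(1-a) + m²/M (`sum_int_convolution_le`). The gain wins
when ta + (t/b²)(1-a) < 1, which in the limit says a < (β - τ₂)/(τ₂(β - 1)); the second term is
harmless because τ₂ < β. The perturbations are then summable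
(`supportsFourierDecay_of_multipliers`), and the limit measure has transform O(|ξ|^(-a)), which
gives dimension at least 2a. -/

/-- The Fourier transform of a real density on the line. -/
noncomputable def densityFourier (ρ : ℝ → ℝ) (ξ : ℝ) : ℂ :=
  ∫ x, (ρ x : ℂ) * Complex.exp (-(2 * Real.pi * ξ * x : ℝ) * Complex.I)

theorem densityFourier_eq_fourier (ρ : ℝ → ℝ) (ξ : ℝ) :
    densityFourier ρ ξ = 𝓕 (fun x => (ρ x : ℂ)) ξ := by
  rw [Real.fourier_real_eq_integral_exp_smul, densityFourier]
  congr 1 with x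
  rw [smul_eq_mul, mul_comm]
  congr 2
  push_cast
  ring

/-- A smooth compactly supported function has Fourier transform decaying faster than any power. -/
theorem exists_fourier_decay {φ : ℝ → ℂ} (hs : HasCompactSupport φ)
    (hc : ContDiff ℝ (⊤ : ℕ∞) φ) (L : ℕ) :
    ∃ C : ℝ, 0 < C ∧ ∀ t : ℝ, ‖𝓕 φ t‖ ≤ C / (1 + |t|) ^ L := by
  set f : 𝓢(ℝ, ℂ) := hs.toSchwartzMap hc with hf
  set g : 𝓢(ℝ, ℂ) := 𝓕 f with hg
  have hgφ : ∀ t, g t = 𝓕 φ t := fun t => by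
    rw [hg, SchwartzMap.fourier_coe]; rfl
  set S := 2 ^ L * ((Finset.Iic (L, 0)).sup fun m => SchwartzMap.seminorm ℝ m.1 m.2) g with hS
  refine ⟨|S| + 1, by positivity, fun t => ?_⟩
  have h := SchwartzMap.one_add_le_sup_seminorm_apply (𝕜 := ℝ) (m := (L, 0)) (k := L) (n := 0)
    le_rfl le_rfl g t
  rw [norm_iteratedFDeriv_zero, Real.norm_eq_abs] at h
  rw [le_div_iff₀ (by positivity), ← hgφ, mul_comm]
  linarith [le_abs_self S]

/-- A smooth probability density supported in a given interval, with rapid Fourier decay. -/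
theorem exists_smooth_density (c r : ℝ) (hr : 0 < r) (L : ℕ) :
    ∃ φ : ℝ → ℝ, ContDiff ℝ (⊤ : ℕ∞) φ ∧ (∀ x, 0 ≤ φ x) ∧ (∀ x, φ x ≠ 0 → |x - c| ≤ r) ∧
      ∫ x, φ x = 1 ∧
      ∃ C : ℝ, 0 < C ∧ ∀ t : ℝ, ‖densityFourier φ t‖ ≤ C / (1 + |t|) ^ L := by
  let f : ContDiffBump c := ⟨r / 2, r, by positivity, by linarith⟩
  have hcd : ContDiff ℝ (⊤ : ℕ∞) (f.normed volume) := f.contDiff_normed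
  refine ⟨f.normed volume, hcd, f.nonneg_normed, fun x hx => ?_, f.integral_normed, ?_⟩
  · have : x ∈ Function.support (f.normed volume) := hx
    rw [f.support_normed_eq, Metric.mem_ball, Real.dist_eq] at this
    exact this.le
  · obtain ⟨C, hC, h⟩ := exists_fourier_decay (φ := fun x => (f.normed volume x : ℂ))
      (f.hasCompactSupport_normed.comp_left (g := fun x : ℝ => (x : ℂ)) (by simp))
      (Complex.ofRealCLM.contDiff.comp hcd) L
    exact ⟨C, hC, fun t => by rw [densityFourier_eq_fourier]; exact h t⟩

theorem densityFourier_rescale (φ : ℝ → ℝ) {w : ℝ} (hw : 0 < w) (t : ℝ) :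
    densityFourier (fun y => w⁻¹ * φ (y / w)) t = densityFourier φ (w * t) := by
  have h := Measure.integral_comp_div (fun y => (φ y : ℂ) *
    Complex.exp (-(2 * Real.pi * (w * t) * y : ℝ) * Complex.I)) w
  rw [densityFourier, densityFourier]
  have e : ∀ x : ℝ, ((w⁻¹ * φ (x / w) : ℝ) : ℂ) *
      Complex.exp (-(2 * Real.pi * t * x : ℝ) * Complex.I) = (w⁻¹ : ℂ) * ((φ (x / w) : ℂ) *
      Complex.exp (-(2 * Real.pi * (w * t) * (x / w) : ℝ) * Complex.I)) := fun x => by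
    have : 2 * Real.pi * (w * t) * (x / w) = 2 * Real.pi * t * x := by field_simp
    rw [this]; push_cast; ring
  simp_rw [e]
  rw [integral_const_mul, h, abs_of_pos hw]
  have : (w : ℂ) ≠ 0 := by exact_mod_cast hw.ne'
  rw [Complex.real_smul, ← mul_assoc, inv_mul_cancel₀ this, one_mul]

theorem summable_norm_fourier_intCast (f : 𝓢(ℝ, ℂ)) :
    Summable fun n : ℤ => ‖(𝓕 f : 𝓢(ℝ, ℂ)) (n : ℝ)‖ := by
  have h : (fun n : ℤ => (𝓕 f : 𝓢(ℝ, ℂ)) (n : ℝ)) =O[cofinite]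
      fun n : ℤ => |(n : ℝ)| ^ (-2 : ℝ) :=
    ((𝓕 f : 𝓢(ℝ, ℂ)).isBigO_cocompact_rpow (-2)).comp_tendsto Int.tendsto_coe_cofinite
  exact summable_of_isBigO (Real.summable_abs_int_rpow one_lt_two) h.norm_left

/-- Nonnegative `1`-periodic functions of mean one, supported within `w` of the integers, with
Fourier coefficients decaying on the scale `w⁻¹`. -/
theorem exists_periodic_kernel : ∃ C : ℝ, 0 < C ∧ ∀ w : ℝ, 0 < w →
    ∃ (h : ℝ → ℝ) (c : ℤ → ℂ), Continuous h ∧ (∀ y, 0 ≤ h y) ∧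
      (∀ y, h y ≠ 0 → ∃ n : ℤ, |y - n| ≤ w) ∧ c 0 = 1 ∧ Summable (fun m => ‖c m‖) ∧
      (∀ m : ℤ, ‖c m‖ ≤ C / (1 + w * |(m : ℝ)|) ^ 5) ∧
      ∀ y : ℝ, HasSum (fun m : ℤ => c m * Complex.exp ((2 * Real.pi * m * y : ℝ) * Complex.I))
        (h y : ℂ) := by
  -- Of the five powers of decay, one will pay for the divisor count and four for the convolution
  -- estimate.
  obtain ⟨φ, hφc, hφ0, hφs, hφi, C, hC, hφd⟩ := exists_smooth_density 0 1 one_pos 5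
  refine ⟨C, hC, fun w hw => ?_⟩
  set ψ : ℝ → ℝ := fun y => w⁻¹ * φ (y / w) with hψ
  have hψc : ContDiff ℝ (⊤ : ℕ∞) ψ := contDiff_const.mul (hφc.comp (contDiff_id.div_const w))
  have hψs : ∀ y, ψ y ≠ 0 → |y| ≤ w := fun y hy => by
    have h1 : φ (y / w) ≠ 0 := right_ne_zero_of_mul hy
    have h2 := hφs _ h1
    rwa [sub_zero, abs_div, abs_of_pos hw, div_le_one hw] at h2
  have hcs : HasCompactSupport (fun y => (ψ y : ℂ)) :=
    HasCompactSupport.of_support_subset_isCompact (isCompact_Icc (a := -w) (b := w))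
      fun y hy => by
        have : ψ y ≠ 0 := fun h0 => hy (by simp [h0])
        exact abs_le.1 (hψs y this)
  have hcd : ContDiff ℝ (⊤ : ℕ∞) (fun y => (ψ y : ℂ)) := Complex.ofRealCLM.contDiff.comp hψc
  have hcoef : ∀ t, 𝓕 (fun y => (ψ y : ℂ)) t = densityFourier φ (w * t) := fun t => by
    rw [← densityFourier_eq_fourier, ← densityFourier_rescale φ hw]
  set c : ℤ → ℂ := fun m => densityFourier φ (w * m) with hc
  have hcb : ∀ m : ℤ, ‖c m‖ ≤ C / (1 + w * |(m : ℝ)|) ^ 5 := fun m => by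
    have := hφd (w * m)
    rwa [abs_mul, abs_of_pos hw] at this
  have hsum : Summable (fun m => ‖c m‖) := by
    refine (summable_norm_fourier_intCast (hcs.toSchwartzMap hcd)).congr fun n => ?_
    show _ = ‖densityFourier φ (w * n)‖
    rw [← hcoef, SchwartzMap.fourier_coe]; rfl
  -- Poisson summation: the Fourier coefficients of the periodization are samples of the transform
  -- of `φ` at `w m`.
  have hP : ∀ y : ℝ, ∑' n : ℤ, (ψ (y + n) : ℂ) =
      ∑' m : ℤ, c m * Complex.exp ((2 * Real.pi * m * y : ℝ) * Complex.I) := fun y => by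
    have h := SchwartzMap.tsum_eq_tsum_fourier (hcs.toSchwartzMap hcd) y
    refine h.trans (tsum_congr fun m => ?_)
    show _ = densityFourier φ (w * m) * _
    rw [SchwartzMap.fourier_coe, ← hcoef, fourier_coe_apply]
    congr 2
    push_cast
    ring
  set h : ℝ → ℝ := fun y => ∑' n : ℤ, ψ (y + n) with hh
  have hnorm : ∀ (m : ℤ) (y : ℝ),
      ‖c m * Complex.exp ((2 * Real.pi * m * y : ℝ) * Complex.I)‖ = ‖c m‖ := fun m y => by
    rw [norm_mul, Complex.norm_exp_ofReal_mul_I, mul_one]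
  have hS : ∀ y : ℝ, HasSum (fun m : ℤ =>
      c m * Complex.exp ((2 * Real.pi * m * y : ℝ) * Complex.I)) (h y : ℂ) := fun y => by
    have : Summable (fun m : ℤ =>
        c m * Complex.exp ((2 * Real.pi * m * y : ℝ) * Complex.I)) :=
      Summable.of_norm (hsum.congr fun m => (hnorm m y).symm)
    have h2 := this.hasSum
    rw [← hP] at h2
    rwa [hh, Complex.ofReal_tsum]
  have hcont : Continuous fun y => (h y : ℂ) := by
    have : (fun y => (h y : ℂ)) = fun y : ℝ => ∑' m : ℤ,
        c m * Complex.exp ((2 * Real.pi * m * y : ℝ) * Complex.I) :=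
      funext fun y => (hS y).tsum_eq.symm
    rw [this]
    refine continuous_tsum (fun m => ?_) hsum (fun m y => (hnorm m y).le)
    fun_prop
  refine ⟨h, c, ?_, fun y => tsum_nonneg fun n => ?_, fun y hy => ?_, ?_, hsum, hcb, hS⟩
  · exact Complex.continuous_re.comp hcont
  · exact mul_nonneg (inv_nonneg.2 hw.le) (hφ0 _)
  · by_contra! hcon
    refine hy ?_
    rw [hh]
    convert tsum_zero with n
    by_contra h0
    have h1 := hψs _ h0
    have h2 := hcon (-n)
    push_cast at h2
    rw [sub_neg_eq_add] at h2
    linarith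
  · simp only [hc, Int.cast_zero, mul_zero, densityFourier]
    simp only [zero_mul, Complex.ofReal_zero, neg_zero, Complex.exp_zero, mul_one]
    rw [integral_complex_ofReal, hφi, Complex.ofReal_one]

end

/-! ### Lattice sums of the decay weight and its convolution with a kernel. -/

/-- Partial sums of a telescoping majorant. -/
theorem sum_range_le_of_le_sub {f g : ℕ → ℝ} {K : ℝ} (h : ∀ n, f n ≤ g (n + 1) - g n)
    (hK : ∀ n, g n - g 0 ≤ K) (n : ℕ) : ∑ i ∈ Finset.range n, f i ≤ K :=
  (Finset.sum_le_sum fun i _ => h i).trans (by rw [Finset.sum_range_sub]; exact hK n)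

theorem sum_range_inv_sq_le {m : ℝ} (hm : 1 ≤ m) (n : ℕ) :
    ∑ i ∈ Finset.range n, ((1 + (i : ℝ) / m) ^ 2)⁻¹ ≤ 2 * m := by
  have hm0 : 0 < m := by linarith
  -- A primitive of twice the summand; the factor 2 absorbs m + i + 1 ≤ 2(m + i).
  refine sum_range_le_of_le_sub (g := fun i => -(2 * m ^ 2 / (m + i))) (fun i => ?_)
    (fun i => ?_) n
  · have hi : (0 : ℝ) ≤ i := Nat.cast_nonneg i
    have e : -(2 * m ^ 2 / (m + (i + 1 : ℕ))) - -(2 * m ^ 2 / (m + i)) =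
        2 * m ^ 2 / ((m + i) * (m + i + 1)) := by
      push_cast; field_simp; ring
    rw [e, inv_eq_one_div, div_le_div_iff₀ (by positivity) (by positivity)]
    have e2 : 2 * m ^ 2 * (1 + i / m) ^ 2 = 2 * (m + i) ^ 2 := by field_simp
    rw [e2]; nlinarith
  · have hi : (0 : ℝ) ≤ i := Nat.cast_nonneg i
    have : 2 * m ^ 2 / (m + ((0 : ℕ) : ℝ)) = 2 * m := by push_cast; field_simp; ring
    have h2 : 0 ≤ 2 * m ^ 2 / (m + i) := by positivity
    linarith

theorem sum_range_sqrt_div_le {m : ℝ} (hm : 1 ≤ m) (n : ℕ) :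
    ∑ i ∈ Finset.range n, √(m / (1 + i)) * ((1 + (i : ℝ) / m) ^ 2)⁻¹ ≤ 8 * m := by
  have hm0 : 0 < m := by linarith
  -- With x = i/m the summand resembles x^(-1/2) (1 + x)^(-2), which is dominated by a multiple of
  -- the derivative of 1 - (1 + √x)⁻¹.
  refine sum_range_le_of_le_sub
    (g := fun i => 8 * m * (1 - (1 + √((i : ℝ) / m))⁻¹)) (fun i => ?_) (fun i => ?_) n
  · have hi : (0 : ℝ) ≤ i := Nat.cast_nonneg i
    set u := √((i : ℝ) / m) with hu
    set v := √(((i + 1 : ℕ) : ℝ) / m) with hv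
    have hu0 : 0 ≤ u := Real.sqrt_nonneg _
    have hv0 : 0 < v := Real.sqrt_pos.2 (by positivity)
    have hu2 : u ^ 2 = i / m := Real.sq_sqrt (by positivity)
    have hv2 : v ^ 2 = (i + 1) / m := by rw [hv, Real.sq_sqrt (by positivity)]; push_cast; rfl
    have huv : u ≤ v := Real.sqrt_le_sqrt (by push_cast; gcongr; linarith)
    have e1 : √(m / (1 + i)) = v⁻¹ := by
      rw [hv, ← Real.sqrt_inv]; congr 1; push_cast; field_simp; ring
    have hd : m * (v ^ 2 - u ^ 2) = 1 := by rw [hu2, hv2]; field_simp; ring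
    have h1m : v ^ 2 ≤ u ^ 2 + 1 := by
      have : m * (v ^ 2 - u ^ 2) ≥ 1 * (v ^ 2 - u ^ 2) := by
        apply mul_le_mul_of_nonneg_right hm; nlinarith
      linarith
    rw [e1, ← hu2]
    have e2 : 8 * m * (1 - (1 + v)⁻¹) - 8 * m * (1 - (1 + u)⁻¹) =
        8 * m * (v - u) / ((1 + u) * (1 + v)) := by
      field_simp; ring
    rw [e2, ← mul_inv, inv_eq_one_div, div_le_div_iff₀ (by positivity) (by positivity), one_mul]
    have e3 : 8 * m * (v - u) * (u + v) = 8 := by linarith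
    have h4 : (1 + u) * (1 + v) ≤ 4 * (1 + u ^ 2) ^ 2 := by
      nlinarith [sq_nonneg u, sq_nonneg (u - 1), sq_nonneg (v - 1)]
    have h5 : 0 ≤ 8 * m * (v - u) := mul_nonneg (by positivity) (by linarith)
    calc (1 + u) * (1 + v) ≤ 4 * (1 + u ^ 2) ^ 2 := h4
      _ = (8 * m * (v - u) * (u + v)) / 2 * (1 + u ^ 2) ^ 2 := by rw [e3]; norm_num
      _ ≤ (8 * m * (v - u) * (2 * v)) / 2 * (1 + u ^ 2) ^ 2 := by gcongr; linarith
      _ = _ := by ring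
  · have : 0 ≤ (1 + √((i : ℝ) / m))⁻¹ := by positivity
    simp only [Nat.cast_zero, zero_div, Real.sqrt_zero, add_zero, inv_one, sub_self, mul_zero,
      sub_zero]
    nlinarith

/-- The weight `(1+|t|)^{-a}(1+|t|/m)^{-2}` controlling the Fourier transform of a density
that is smooth at scale `1/m`. -/
noncomputable def decayWeight (a m t : ℝ) : ℝ := (1 + |t|) ^ (-a) * ((1 + |t| / m) ^ 2)⁻¹

theorem decayWeight_pos (a t : ℝ) {m : ℝ} (hm : 0 < m) : 0 < decayWeight a m t := by
  unfold decayWeight; positivity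

/-- The factor (m/(1+i))^a is at most its square-root analogue when m ≥ 1 + i, because a ≤ 1/2, and
at most 1 otherwise; the two terms cover both cases. -/
theorem decayWeight_nat_le {a m : ℝ} (ha : 0 ≤ a) (ha' : a ≤ 1 / 2) (hm : 1 ≤ m) (i : ℕ) :
    decayWeight a m i ≤ m ^ (-a) * (√(m / (1 + i)) * ((1 + (i : ℝ) / m) ^ 2)⁻¹ +
      ((1 + (i : ℝ) / m) ^ 2)⁻¹) := by
  have hm0 : 0 < m := by linarith
  have hi : (0 : ℝ) ≤ i := Nat.cast_nonneg i
  rw [decayWeight, Nat.abs_cast, ← add_one_mul, ← mul_assoc]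
  gcongr
  have e : (1 + (i : ℝ)) ^ (-a) = m ^ (-a) * (m / (1 + i)) ^ a := by
    rw [Real.div_rpow hm0.le (by positivity), Real.rpow_neg hm0.le, Real.rpow_neg (by positivity)]
    have := Real.rpow_pos_of_pos hm0 a
    field_simp
  rw [e]
  gcongr
  rcases le_total 1 (m / (1 + i)) with h | h
  · have := Real.rpow_le_rpow_of_exponent_le h ha'
    rw [← Real.sqrt_eq_rpow] at this
    linarith
  · have := Real.rpow_le_one (by positivity) h ha
    linarith [Real.sqrt_nonneg (m / (1 + i))]

theorem sum_range_decayWeight_le {a m : ℝ} (ha : 0 ≤ a) (ha' : a ≤ 1 / 2) (hm : 1 ≤ m) (n : ℕ) :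
    ∑ i ∈ Finset.range n, decayWeight a m i ≤ 10 * m ^ (1 - a) := by
  have hm0 : 0 < m := by linarith
  calc ∑ i ∈ Finset.range n, decayWeight a m i
      ≤ ∑ i ∈ Finset.range n, m ^ (-a) * (√(m / (1 + i)) * ((1 + (i : ℝ) / m) ^ 2)⁻¹ +
        ((1 + (i : ℝ) / m) ^ 2)⁻¹) := Finset.sum_le_sum fun i _ => decayWeight_nat_le ha ha' hm i
    _ ≤ m ^ (-a) * (8 * m + 2 * m) := by
        rw [← Finset.mul_sum, Finset.sum_add_distrib]
        gcongr
        · exact sum_range_sqrt_div_le hm n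
        · exact sum_range_inv_sq_le hm n
    _ = _ := by
        rw [sub_eq_neg_add, Real.rpow_add hm0, Real.rpow_one]; ring

/-- Sums over the integers of a function of `|s|`. -/
theorem sum_int_le_of_sum_range_le {f : ℤ → ℝ} {g : ℕ → ℝ} {K : ℝ} (h0 : ∀ n, 0 ≤ g n)
    (hfg : ∀ s : ℤ, f s ≤ g s.natAbs) (hK : ∀ n, ∑ i ∈ Finset.range n, g i ≤ K)
    (S : Finset ℤ) : ∑ s ∈ S, f s ≤ 2 * K := by
  classical
  set n := S.sup Int.natAbs + 1 with hn
  have hS : ∀ s ∈ S, s.natAbs ∈ Finset.range n := fun s hs =>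
    Finset.mem_range.2 (Nat.lt_succ_of_le (Finset.le_sup (f := Int.natAbs) hs))
  calc ∑ s ∈ S, f s ≤ ∑ s ∈ S, g s.natAbs := Finset.sum_le_sum fun s _ => hfg s
    _ = ∑ i ∈ Finset.range n, ∑ s ∈ S with s.natAbs = i, g s.natAbs :=
        (Finset.sum_fiberwise_of_maps_to hS _).symm
    _ ≤ ∑ i ∈ Finset.range n, 2 * g i := by
        refine Finset.sum_le_sum fun i _ => ?_
        have hc : (S.filter fun s => s.natAbs = i).card ≤ 2 := by
          have hsub : (S.filter fun s => s.natAbs = i) ⊆ {(i : ℤ), -(i : ℤ)} := by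
            intro s hs
            have := (Finset.mem_filter.1 hs).2
            simp only [Finset.mem_insert, Finset.mem_singleton]
            omega
          exact (Finset.card_le_card hsub).trans Finset.card_le_two
        calc ∑ s ∈ S with s.natAbs = i, g s.natAbs = ∑ s ∈ S with s.natAbs = i, g i :=
              Finset.sum_congr rfl fun s hs => by rw [(Finset.mem_filter.1 hs).2]
          _ = ((S.filter fun s => s.natAbs = i).card : ℝ) * g i := by
              rw [Finset.sum_const, nsmul_eq_mul]
          _ ≤ 2 * g i := by
              apply mul_le_mul_of_nonneg_right _ (h0 i); exact_mod_cast hc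
    _ ≤ 2 * K := by rw [← Finset.mul_sum]; linarith [hK n]

theorem decayWeight_anti {a m t u : ℝ} (ha : 0 ≤ a) (hm : 0 < m) (h : |t| ≤ |u|) :
    decayWeight a m u ≤ decayWeight a m t := by
  unfold decayWeight
  have : (1 + |u|) ^ (-a) ≤ (1 + |t|) ^ (-a) :=
    Real.rpow_le_rpow_of_nonpos (by positivity) (by linarith) (by linarith)
  gcongr

theorem decayWeight_half_le {a m : ℝ} (ha' : a ≤ 1) (hm : 0 < m) (t : ℝ) :
    decayWeight a m (t / 2) ≤ 8 * decayWeight a m t := by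
  unfold decayWeight
  have ht := abs_nonneg t
  have e : |t / 2| = |t| / 2 := by rw [abs_div]; norm_num
  have h1 : (1 + |t / 2|) ^ (-a) ≤ 2 * (1 + |t|) ^ (-a) := by
    rcases le_total 0 a with ha | ha
    · calc (1 + |t / 2|) ^ (-a) ≤ ((1 + |t|) / 2) ^ (-a) :=
          Real.rpow_le_rpow_of_nonpos (by positivity) (by rw [e]; linarith) (by linarith)
        _ = 2 ^ a * (1 + |t|) ^ (-a) := by
          rw [Real.div_rpow (by positivity) (by norm_num), Real.rpow_neg (by norm_num : (0:ℝ) ≤ 2),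
            div_inv_eq_mul, mul_comm]
        _ ≤ 2 * (1 + |t|) ^ (-a) := by
          gcongr
          calc (2 : ℝ) ^ a ≤ 2 ^ (1 : ℝ) := Real.rpow_le_rpow_of_exponent_le (by norm_num) ha'
            _ = 2 := Real.rpow_one 2
    · calc (1 + |t / 2|) ^ (-a) ≤ (1 + |t|) ^ (-a) :=
          Real.rpow_le_rpow (by positivity) (by rw [e]; linarith) (by linarith)
        _ ≤ 2 * (1 + |t|) ^ (-a) := by
          have : 0 < (1 + |t|) ^ (-a) := by positivity
          linarith
  have h2 : ((1 + |t / 2| / m) ^ 2)⁻¹ ≤ 4 * ((1 + |t| / m) ^ 2)⁻¹ := by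
    rw [inv_eq_one_div, inv_eq_one_div, mul_one_div, div_le_div_iff₀ (by positivity)
      (by positivity), e]
    have : 0 ≤ |t| / m := by positivity
    have e3 : |t| / 2 / m = |t| / m / 2 := by ring
    rw [e3]; nlinarith
  calc _ ≤ (2 * (1 + |t|) ^ (-a)) * (4 * ((1 + |t| / m) ^ 2)⁻¹) := by gcongr
    _ = _ := by ring

/-- If n is the integer nearest to ξ, then |n - s| ≤ 2|ξ - s| for all integers s, and halving the
argument of the weight costs a factor 8. Hence the bound is uniform in ξ. -/
theorem sum_int_decayWeight_le {a m : ℝ} (ha : 0 ≤ a) (ha' : a ≤ 1 / 2) (hm : 1 ≤ m) (ξ : ℝ)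
    (S : Finset ℤ) : ∑ s ∈ S, decayWeight a m (ξ - s) ≤ 320 * m ^ (1 - a) := by
  classical
  have hm0 : 0 < m := by linarith
  set n : ℤ := round ξ with hn
  have hr : |ξ - n| ≤ 1 / 2 := abs_sub_round ξ
  -- an integer translate of `S` is compared with the lattice points themselves
  have key : ∀ s : ℤ, decayWeight a m (ξ - s) ≤ 8 * decayWeight a m ((n - s).natAbs : ℕ) := by
    intro s
    refine le_trans ?_ (decayWeight_half_le (by linarith) hm0 _)
    refine decayWeight_anti ha hm0 ?_
    have h1 : (((n - s).natAbs : ℕ) : ℝ) = |(n : ℝ) - s| := by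
      rw [Nat.cast_natAbs]; push_cast; rfl
    rw [h1, abs_div, abs_abs, abs_of_pos (by norm_num : (0 : ℝ) < 2)]
    rcases eq_or_ne n s with h | h
    · rw [h]; simp
    · have h2 : (1 : ℝ) ≤ |(n : ℝ) - s| := by
        have : (1 : ℤ) ≤ |n - s| := Int.one_le_abs (sub_ne_zero.2 h)
        exact_mod_cast this
      have h3 : |(n : ℝ) - s| ≤ |ξ - s| + |ξ - n| := by
        have := abs_sub_le (n : ℝ) ξ s
        rw [abs_sub_comm (n : ℝ) ξ] at this
        linarith
      linarith
  have hb := sum_int_le_of_sum_range_le (f := fun s => 8 * decayWeight a m (s.natAbs : ℕ))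
    (g := fun i => 8 * decayWeight a m i) (K := 8 * (10 * m ^ (1 - a)))
    (fun i => by have := decayWeight_pos a i hm0; positivity) (fun s => le_rfl)
    (fun k => by rw [← Finset.mul_sum]; gcongr; exact sum_range_decayWeight_le ha ha' hm k)
    (S.image fun s => n - s)
  rw [Finset.sum_image (by intro x _ y _ h; simpa using h)] at hb
  calc _ ≤ ∑ s ∈ S, 8 * decayWeight a m ((n - s).natAbs : ℕ) := Finset.sum_le_sum fun s _ => key s
    _ ≤ _ := hb
    _ ≤ _ := by
      have : 0 < m ^ (1 - a) := by positivity
      linarith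

theorem sum_int_inv_pow_four_le {M : ℝ} (hM : 1 ≤ M) (S : Finset ℤ) :
    ∑ s ∈ S, ((1 + |(s : ℝ)| / M) ^ 4)⁻¹ ≤ 4 * M := by
  have hM0 : 0 < M := by linarith
  have := sum_int_le_of_sum_range_le (f := fun s : ℤ => ((1 + |(s : ℝ)| / M) ^ 4)⁻¹)
    (g := fun i => ((1 + (i : ℝ) / M) ^ 2)⁻¹) (K := 2 * M) (fun i => by positivity)
    (fun s => ?_) (fun n => sum_range_inv_sq_le hM n) S
  · linarith
  · have e : ((s.natAbs : ℕ) : ℝ) = |(s : ℝ)| := by rw [Nat.cast_natAbs]; push_cast; rfl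
    rw [e]
    have h1 : 1 ≤ 1 + |(s : ℝ)| / M := le_add_of_nonneg_right (by positivity)
    exact inv_anti₀ (by positivity) (pow_le_pow_right₀ h1 (by norm_num))

theorem one_add_rpow_le {a M t : ℝ} (ha : 0 ≤ a) (ha' : a ≤ 1) (hM : 1 ≤ M) (ht : 0 ≤ t) :
    (1 + t) ^ a ≤ M ^ a * (1 + t / M) := by
  have hM0 : 0 < M := by linarith
  have h1 : (1 : ℝ) ≤ 1 + t / M := le_add_of_nonneg_right (by positivity)
  calc (1 + t) ^ a ≤ (M * (1 + t / M)) ^ a := by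
        apply Real.rpow_le_rpow (by positivity) _ ha
        have : M * (1 + t / M) = M + t := by field_simp
        linarith
    _ = M ^ a * (1 + t / M) ^ a := Real.mul_rpow hM0.le (by positivity)
    _ ≤ M ^ a * (1 + t / M) ^ (1 : ℝ) := by
        gcongr
    _ = _ := by rw [Real.rpow_one]

/-- When |ξ| ≤ M or |s| ≥ |ξ|/2, the kernel factor pays for the reciprocal of the target weight, up
to M^a. In the remaining case |ξ - s| ≥ |ξ|/2 with |ξ| ≥ M, and the quadratic tails of the two
weights compare with ratio (m/M)². -/
theorem convolution_term_le {a m M : ℝ} (ha : 0 ≤ a) (ha' : a ≤ 1 / 2) (hm : 1 ≤ m) (hM : 1 ≤ M)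
    (ξ s : ℝ) :
    ((1 + |s| / M) ^ 4)⁻¹ * decayWeight a m (ξ - s) ≤
      (8 * M ^ a * decayWeight a m (ξ - s) + 32 * (m / M) ^ 2 * ((1 + |s| / M) ^ 4)⁻¹) *
        decayWeight a M ξ := by
  have hm0 : 0 < m := by linarith
  have hM0 : 0 < M := by linarith
  set T := (1 + |ξ|) ^ a * (1 + |ξ| / M) ^ 2 with hT
  have hT0 : 0 < T := by positivity
  have hTW : decayWeight a M ξ = T⁻¹ := by
    rw [decayWeight, hT, mul_inv, Real.rpow_neg (by positivity)]
  rw [hTW, ← div_eq_mul_inv, le_div_iff₀ hT0]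
  set w := decayWeight a m (ξ - s) with hw
  have hw0 : 0 < w := decayWeight_pos a _ hm0
  set v := ((1 + |s| / M) ^ 4)⁻¹ with hv
  have hv0 : 0 < v := by positivity
  have hv1 : v ≤ 1 := inv_le_one_of_one_le₀ (one_le_pow₀ (le_add_of_nonneg_right (by positivity)))
  have hTle : T ≤ M ^ a * (1 + |ξ| / M) ^ 3 := by
    calc T ≤ (M ^ a * (1 + |ξ| / M)) * (1 + |ξ| / M) ^ 2 := by
          rw [hT]; gcongr; exact one_add_rpow_le ha (by linarith) hM (abs_nonneg _)
      _ = _ := by ring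
  -- `T` is the reciprocal of the target weight; this settles the two cases in which the kernel `v`
  -- alone controls it.
  have hA : T * v ≤ 8 * M ^ a → v * w * T ≤ 8 * M ^ a * w + 32 * (m / M) ^ 2 * v := fun h => by
    have : v * w * T ≤ 8 * M ^ a * w := by nlinarith
    have : 0 ≤ 32 * (m / M) ^ 2 * v := by positivity
    linarith
  rcases le_total |ξ| M with h1 | h1
  · refine hA ?_
    have : |ξ| / M ≤ 1 := (div_le_one hM0).2 h1
    have h3 : (1 + |ξ| / M) ^ 3 ≤ 8 := by
      calc (1 + |ξ| / M) ^ 3 ≤ 2 ^ 3 := by gcongr; linarith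
        _ = 8 := by norm_num
    calc T * v ≤ (M ^ a * (1 + |ξ| / M) ^ 3) * 1 := by gcongr
      _ ≤ (M ^ a * 8) * 1 := by gcongr
      _ = _ := by ring
  rcases le_total (|ξ| / 2) |s| with h2 | h2
  · refine hA ?_
    have h3 : 1 + |ξ| / M ≤ 2 * (1 + |s| / M) := by
      have : |ξ| / M ≤ (2 * |s|) / M := by gcongr; linarith
      have e : 2 * |s| / M = 2 * (|s| / M) := by ring
      linarith
    have h4 : (1 + |s| / M) ^ 3 * v ≤ 1 := by
      rw [hv, ← div_eq_mul_inv, div_le_one (by positivity)]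
      exact pow_le_pow_right₀ (le_add_of_nonneg_right (by positivity)) (by norm_num)
    calc T * v ≤ (M ^ a * (2 * (1 + |s| / M)) ^ 3) * v := by
          gcongr; exact hTle.trans (by gcongr)
      _ = 8 * M ^ a * ((1 + |s| / M) ^ 3 * v) := by ring
      _ ≤ 8 * M ^ a * 1 := by gcongr
      _ = _ := by ring
  · have h3 : |ξ| / 2 ≤ |ξ - s| := by
      have := abs_sub_abs_le_abs_sub ξ s
      linarith
    have hξ : 0 < |ξ| := by linarith
    have h4 : w ≤ 2 * (1 + |ξ|) ^ (-a) * (4 * m ^ 2 / |ξ| ^ 2) := by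
      have e1 : (1 + |ξ - s|) ^ (-a) ≤ 2 * (1 + |ξ|) ^ (-a) := by
        calc (1 + |ξ - s|) ^ (-a) ≤ ((1 + |ξ|) / 2) ^ (-a) :=
            Real.rpow_le_rpow_of_nonpos (by positivity) (by linarith) (by linarith)
          _ = 2 ^ a * (1 + |ξ|) ^ (-a) := by
            rw [Real.div_rpow (by positivity) (by norm_num),
              Real.rpow_neg (by norm_num : (0:ℝ) ≤ 2), div_inv_eq_mul, mul_comm]
          _ ≤ 2 * (1 + |ξ|) ^ (-a) := by
            gcongr
            calc (2 : ℝ) ^ a ≤ 2 ^ (1 : ℝ) :=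
                  Real.rpow_le_rpow_of_exponent_le (by norm_num) (by linarith)
              _ = 2 := Real.rpow_one 2
      have e2 : ((1 + |ξ - s| / m) ^ 2)⁻¹ ≤ 4 * m ^ 2 / |ξ| ^ 2 := by
        have : |ξ| / (2 * m) ≤ 1 + |ξ - s| / m := by
          have : |ξ| / 2 / m ≤ |ξ - s| / m := by gcongr
          have e : |ξ| / (2 * m) = |ξ| / 2 / m := by rw [div_div]
          linarith
        calc ((1 + |ξ - s| / m) ^ 2)⁻¹ ≤ ((|ξ| / (2 * m)) ^ 2)⁻¹ := by gcongr
          _ = _ := by field_simp; ring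
      rw [hw, decayWeight]
      gcongr
    have h5 : T ≤ (1 + |ξ|) ^ a * (4 * |ξ| ^ 2 / M ^ 2) := by
      rw [hT]
      gcongr
      have : 1 ≤ |ξ| / M := (one_le_div hM0).2 h1
      calc (1 + |ξ| / M) ^ 2 ≤ (2 * (|ξ| / M)) ^ 2 := by gcongr; linarith
        _ = _ := by ring
    have h6 : w * T ≤ 32 * (m / M) ^ 2 := by
      calc w * T ≤ (2 * (1 + |ξ|) ^ (-a) * (4 * m ^ 2 / |ξ| ^ 2)) *
            ((1 + |ξ|) ^ a * (4 * |ξ| ^ 2 / M ^ 2)) := by gcongr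
        _ = 32 * (m / M) ^ 2 * ((1 + |ξ|) ^ (-a) * (1 + |ξ|) ^ a) := by field_simp; ring
        _ = 32 * (m / M) ^ 2 := by
          rw [← Real.rpow_add (by positivity), neg_add_cancel, Real.rpow_zero, mul_one]
    have : 0 ≤ 8 * M ^ a * w := by positivity
    nlinarith

/-- Convolving the weight at scale `m` with a kernel at scale `M` gives the weight at scale `M`,
with a gain. -/
theorem sum_int_convolution_le {a m M : ℝ} (ha : 0 ≤ a) (ha' : a ≤ 1 / 2) (hm : 1 ≤ m)
    (hM : 1 ≤ M) (ξ : ℝ) (S : Finset ℤ) :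
    ∑ s ∈ S, ((1 + |(s : ℝ)| / M) ^ 4)⁻¹ * decayWeight a m (ξ - s) ≤
      2560 * (M ^ a * m ^ (1 - a) + m ^ 2 / M) * decayWeight a M ξ := by
  have hM0 : 0 < M := by linarith
  have hm0 : 0 < m := by linarith
  refine (Finset.sum_le_sum (s := S) fun s _ => convolution_term_le ha ha' hm hM ξ (s : ℝ)).trans ?_
  rw [← Finset.sum_mul]
  have hW := decayWeight_pos a ξ hM0
  refine mul_le_mul_of_nonneg_right ?_ hW.le
  rw [Finset.sum_add_distrib, ← Finset.mul_sum, ← Finset.mul_sum]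
  calc _ ≤ 8 * M ^ a * (320 * m ^ (1 - a)) + 32 * (m / M) ^ 2 * (4 * M) := by
        gcongr
        · exact sum_int_decayWeight_le ha ha' hm ξ S
        · exact sum_int_inv_pow_four_le hM S
    _ = 2560 * (M ^ a * m ^ (1 - a)) + 128 * (m ^ 2 / M) := by field_simp; ring
    _ ≤ _ := by
      have : 0 ≤ m ^ 2 / M := by positivity
      linarith

/-! ### Large primes: how many there are, and how many divide an integer. -/

/-- The primes in the interval `(Y, N]`. -/
noncomputable def primesIoc (Y N : ℝ) : Finset ℕ := (Nat.primesLE ⌊N⌋₊).filter fun p => Y < p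

theorem mem_primesIoc {Y N : ℝ} (hN : 0 ≤ N) {p : ℕ} :
    p ∈ primesIoc Y N ↔ p.Prime ∧ Y < p ∧ (p : ℝ) ≤ N := by
  rw [primesIoc, Finset.mem_filter, Nat.mem_primesLE, Nat.le_floor_iff hN]
  tauto

/-- The product of these divisors exceeds a power of Y and divides s, so their number is at most
log|s| / log Y, while log|s| ≤ log M + |s|/M. The constant D stays bounded when M is a fixed power
of Y. -/
theorem card_prime_divisors_le {P : Finset ℕ} {Y M D : ℝ} (hP : ∀ q ∈ P, q.Prime ∧ Y < q)
    (hY : 0 < Y) (hlog : 1 ≤ Real.log Y) (hM : 0 < M) (hD : 1 ≤ D)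
    (hMD : Real.log M ≤ D * Real.log Y) {s : ℤ} (hs : s ≠ 0) :
    ((P.filter fun q : ℕ => (q : ℤ) ∣ s).card : ℝ) ≤ D * (1 + |(s : ℝ)| / M) := by
  set Q := P.filter fun q : ℕ => (q : ℤ) ∣ s with hQ
  have hs0 : 0 < |(s : ℝ)| := abs_pos.2 (by exact_mod_cast hs)
  have hdvd : ∏ q ∈ Q, q ∣ s.natAbs :=
    Finset.prod_primes_dvd _ (fun q hq => (hP q (Finset.mem_filter.1 hq).1).1.prime)
      fun q hq => Int.natCast_dvd.1 (Finset.mem_filter.1 hq).2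
  have hle : Y ^ Q.card ≤ |(s : ℝ)| := by
    calc Y ^ Q.card = ∏ _q ∈ Q, Y := by rw [Finset.prod_const]
      _ ≤ ∏ q ∈ Q, (q : ℝ) := Finset.prod_le_prod (fun _ _ => hY.le)
          fun q hq => (hP q (Finset.mem_filter.1 hq).1).2.le
      _ = ((∏ q ∈ Q, q : ℕ) : ℝ) := by push_cast; rfl
      _ ≤ (s.natAbs : ℝ) := by
          exact_mod_cast Nat.le_of_dvd (Int.natAbs_pos.2 hs) hdvd
      _ = |(s : ℝ)| := by rw [Nat.cast_natAbs]; push_cast; rfl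
  have h1 : (Q.card : ℝ) * Real.log Y ≤ Real.log |(s : ℝ)| := by
    rw [← Real.log_pow]; exact Real.log_le_log (by positivity) hle
  have h2 : Real.log |(s : ℝ)| ≤ Real.log M + |(s : ℝ)| / M := by
    have := Real.log_le_sub_one_of_pos (div_pos hs0 hM)
    rw [Real.log_div hs0.ne' hM.ne'] at this
    linarith
  have h3 : |(s : ℝ)| / M ≤ D * (|(s : ℝ)| / M) * Real.log Y := by
    have : 0 ≤ |(s : ℝ)| / M := by positivity
    have : 1 ≤ D * Real.log Y := by nlinarith
    nlinarith
  have h4 : (Q.card : ℝ) * Real.log Y ≤ (D * (1 + |(s : ℝ)| / M)) * Real.log Y := by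
    linarith
  exact le_of_mul_le_mul_right h4 (by linarith)

/-- Chebyshev's lower bound gives at least 2N^(1-ε) primes up to N, and at most N^(1-ε) of them are
discarded. -/
theorem eventually_card_primesIoc_ge {ε : ℝ} (hε : 0 < ε) (hε' : ε < 1) :
    ∀ᶠ N : ℝ in atTop, N ^ (1 - ε) ≤ ((primesIoc (N ^ (1 - ε)) N).card : ℝ) := by
  have hlog : ∀ᶠ N : ℝ in atTop, Real.log N ≤ N ^ ε / 8 := by
    have h := (isLittleO_log_rpow_atTop hε).def (by norm_num : (0 : ℝ) < 1 / 8)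
    filter_upwards [h, eventually_ge_atTop 1] with N h hN
    rw [Real.norm_of_nonneg (Real.log_nonneg hN), Real.norm_of_nonneg (by positivity)] at h
    linarith
  have hlog2 : ∀ᶠ N : ℝ in atTop, Real.log (N + 2) ≤ N / 8 := by
    have h := Real.isLittleO_log_id_atTop.def (by norm_num : (0 : ℝ) < 1 / 16)
    have h2 := (tendsto_atTop_add_const_right atTop (2 : ℝ) tendsto_id).eventually h
    filter_upwards [h2, eventually_ge_atTop 2] with N h hN
    simp only [id] at h
    rw [Real.norm_of_nonneg (Real.log_nonneg (by linarith)),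
      Real.norm_of_nonneg (by linarith)] at h
    linarith
  filter_upwards [hlog, hlog2, eventually_ge_atTop 16] with N h1 h2 hN
  have hN0 : 0 < N := by linarith
  have hpi := Chebyshev.pi_ge' (x := N) (by linarith)
  have hlogpos : 0 < Real.log N := Real.log_pos (by linarith)
  have hl2 : (1 : ℝ) / 2 ≤ Real.log 2 := by linarith [Real.log_two_gt_d9]
  have hpow : N ^ (1 - ε) * N ^ ε = N := by
    rw [← Real.rpow_add hN0]; simp
  have hy0 : 0 < N ^ (1 - ε) := by positivity
  have hbig : 2 * N ^ (1 - ε) ≤ (Nat.primeCounting ⌊N⌋₊ : ℝ) := by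
    refine le_trans ?_ hpi
    rw [le_div_iff₀ hlogpos]
    have : N ^ (1 - ε) * Real.log N ≤ N / 8 := by
      calc _ ≤ N ^ (1 - ε) * (N ^ ε / 8) := by gcongr
        _ = N / 8 := by rw [← mul_div_assoc, hpow]
    nlinarith
  have hcard : (Nat.primeCounting ⌊N⌋₊ : ℝ) ≤ (primesIoc (N ^ (1 - ε)) N).card + N ^ (1 - ε) := by
    rw [← Nat.primesLE_card_eq_primeCounting,
      ← Finset.card_filter_add_card_filter_not (fun p : ℕ => N ^ (1 - ε) < p)]
    push_cast
    gcongr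
    · exact le_rfl
    · have hsub : ((Nat.primesLE ⌊N⌋₊).filter fun p : ℕ => ¬ N ^ (1 - ε) < (p : ℝ)) ⊆
          Finset.Icc 1 ⌊N ^ (1 - ε)⌋₊ := by
        intro p hp
        obtain ⟨hp1, hp2⟩ := Finset.mem_filter.1 hp
        rw [Finset.mem_Icc, Nat.le_floor_iff hy0.le]
        exact ⟨(Nat.mem_primesLE.1 hp1).2.one_le, not_lt.1 hp2⟩
      have := Finset.card_le_card hsub
      rw [Nat.card_Icc, Nat.add_sub_cancel] at this
      calc _ ≤ ((⌊N ^ (1 - ε)⌋₊ : ℕ) : ℝ) := by exact_mod_cast this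
        _ ≤ _ := Nat.floor_le hy0.le
  linarith

/-! ### Multiplying a density by an average of periodic kernels. -/

theorem norm_exp_neg_ofReal_mul_I (x : ℝ) : ‖Complex.exp (-(x : ℂ) * Complex.I)‖ = 1 := by
  rw [← Complex.ofReal_neg, Complex.norm_exp_ofReal_mul_I]

theorem integrable_density_mul_exp {ρ : ℝ → ℝ} (hρ : Integrable ρ) (ξ : ℝ) :
    Integrable fun x => (ρ x : ℂ) * Complex.exp (-(2 * Real.pi * ξ * x : ℝ) * Complex.I) := by
  refine hρ.ofReal.mul_bdd (c := 1) ?_ (ae_of_all _ fun x => (norm_exp_neg_ofReal_mul_I _).le)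
  exact Continuous.aestronglyMeasurable (by fun_prop)

/-- Multiplying a density by an absolutely convergent Fourier series. -/
theorem hasSum_densityFourier_mul {ρ h : ℝ → ℝ} {c : ℤ → ℂ} (hρ : Integrable ρ)
    (hc : Summable fun m => ‖c m‖)
    (hh : ∀ y : ℝ, HasSum (fun m : ℤ =>
      c m * Complex.exp ((2 * Real.pi * m * y : ℝ) * Complex.I)) (h y : ℂ)) (q t ξ : ℝ) :
    HasSum (fun m : ℤ => c m * Complex.exp ((2 * Real.pi * m * t : ℝ) * Complex.I) *
      densityFourier ρ (ξ - m * q)) (densityFourier (fun x => ρ x * h (q * x + t)) ξ) := by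
  set F : ℤ → ℝ → ℂ := fun m x => c m * Complex.exp ((2 * Real.pi * m * t : ℝ) * Complex.I) *
    ((ρ x : ℂ) * Complex.exp (-(2 * Real.pi * (ξ - m * q) * x : ℝ) * Complex.I)) with hF
  have hFi : ∀ m, Integrable (F m) := fun m => (integrable_density_mul_exp hρ _).const_mul _
  have hFn : ∀ m x, ‖F m x‖ = ‖c m‖ * ‖ρ x‖ := fun m x => by
    simp only [hF, norm_mul, Complex.norm_exp_ofReal_mul_I, norm_exp_neg_ofReal_mul_I,
      Complex.norm_real, mul_one]
  have hS : Summable fun m => ∫ x, ‖F m x‖ := by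
    simp_rw [hFn, integral_const_mul]
    exact hc.mul_right _
  have h1 := hasSum_integral_of_summable_integral_norm hFi hS
  have e1 : ∀ m, ∫ x, F m x = c m * Complex.exp ((2 * Real.pi * m * t : ℝ) * Complex.I) *
      densityFourier ρ (ξ - m * q) := fun m => by
    rw [densityFourier, ← integral_const_mul]
  have e2 : ∫ x, ∑' m, F m x = densityFourier (fun x => ρ x * h (q * x + t)) ξ := by
    rw [densityFourier]
    congr 1 with x
    have h2 := (hh (q * x + t)).mul_left
      ((ρ x : ℂ) * Complex.exp (-(2 * Real.pi * ξ * x : ℝ) * Complex.I))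
    have e3 : (fun m : ℤ => (ρ x : ℂ) * Complex.exp (-(2 * Real.pi * ξ * x : ℝ) * Complex.I) *
        (c m * Complex.exp ((2 * Real.pi * m * (q * x + t) : ℝ) * Complex.I))) =
        fun m => F m x := by
      funext m
      have : Complex.exp (-(2 * Real.pi * ξ * x : ℝ) * Complex.I) *
          Complex.exp ((2 * Real.pi * m * (q * x + t) : ℝ) * Complex.I) =
          Complex.exp ((2 * Real.pi * m * t : ℝ) * Complex.I) *
          Complex.exp (-(2 * Real.pi * (ξ - m * q) * x : ℝ) * Complex.I) := by
        rw [← Complex.exp_add, ← Complex.exp_add]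
        congr 1
        push_cast
        ring
      rw [hF]
      linear_combination (ρ x : ℂ) * c m * this
    rw [e3] at h2
    rw [h2.tsum_eq]
    push_cast
    ring
  rw [e2] at h1
  simpa only [e1] using h1

/-- Group the pairs (m, q) by s = mq: each q dividing s determines m. Frequencies coming from
different q therefore overlap only as often as s has divisors in P, which lets the average over P
gain its full size. -/
theorem sum_mul_le_sum_dvd {G : ℤ → ℝ} (hG : ∀ s, 0 ≤ G s) {d : ℤ → ℝ} (S : Finset ℤ)
    (hS : (0 : ℤ) ∉ S) (P : Finset ℕ) (hP : ∀ q ∈ P, q ≠ 0)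
    (hd : ∀ s : ℤ, s ≠ 0 → ((P.filter fun q : ℕ => (q : ℤ) ∣ s).card : ℝ) ≤ d s) :
    ∃ T : Finset ℤ, ∑ m ∈ S, ∑ q ∈ P, G (m * q) ≤ ∑ s ∈ T, d s * G s := by
  classical
  refine ⟨(S ×ˢ P).image fun x => x.1 * (x.2 : ℤ), ?_⟩
  rw [← Finset.sum_product', ← Finset.sum_fiberwise_of_maps_to
    (g := fun x : ℤ × ℕ => x.1 * (x.2 : ℤ)) (fun x hx => Finset.mem_image_of_mem _ hx)]
  refine Finset.sum_le_sum fun s hs => ?_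
  have hs0 : s ≠ 0 := by
    obtain ⟨x, hx, rfl⟩ := Finset.mem_image.1 hs
    obtain ⟨h1, h2⟩ := Finset.mem_product.1 hx
    exact mul_ne_zero (fun h => hS (h ▸ h1)) (by exact_mod_cast hP _ h2)
  set Q := (S ×ˢ P).filter fun x => x.1 * (x.2 : ℤ) = s with hQ
  have hcard : Q.card ≤ (P.filter fun q : ℕ => (q : ℤ) ∣ s).card := by
    refine Finset.card_le_card_of_injOn Prod.snd (fun x hx => ?_) fun x hx y hy hxy => ?_
    · obtain ⟨h1, h2⟩ := Finset.mem_filter.1 (Finset.mem_coe.1 hx)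
      exact Finset.mem_coe.2 (Finset.mem_filter.2 ⟨(Finset.mem_product.1 h1).2,
        Dvd.intro_left _ h2⟩)
    · obtain ⟨h1, h2⟩ := Finset.mem_filter.1 (Finset.mem_coe.1 hx)
      obtain ⟨h3, h4⟩ := Finset.mem_filter.1 (Finset.mem_coe.1 hy)
      have hne : (x.2 : ℤ) ≠ 0 := by exact_mod_cast hP _ (Finset.mem_product.1 h1).2
      refine Prod.ext (mul_right_cancel₀ hne ?_) hxy
      rw [h2, ← h4, hxy]
  calc ∑ x ∈ Q, G (x.1 * (x.2 : ℤ)) = ∑ x ∈ Q, G s :=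
        Finset.sum_congr rfl fun x hx => by rw [(Finset.mem_filter.1 hx).2]
    _ = (Q.card : ℝ) * G s := by rw [Finset.sum_const, nsmul_eq_mul]
    _ ≤ d s * G s := by
        refine mul_le_mul_of_nonneg_right (le_trans ?_ (hd s hs0)) (hG s)
        exact_mod_cast hcard

/-- The effect on the Fourier transform of multiplying a density by an average over `q ∈ P` of
`1/q`-periodic kernels. -/
theorem norm_densityFourier_mul_average_sub_le {ρ : ℝ → ℝ} (hρ : Integrable ρ)
    {P : Finset ℕ} (hPne : P.Nonempty) (hP : ∀ q ∈ P, q ≠ 0)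
    {h : ℕ → ℝ → ℝ} {c : ℕ → ℤ → ℂ} {t w : ℕ → ℝ} {C D a m M B : ℝ} (hC : 0 < C) (hD : 0 < D)
    (ha : 0 ≤ a) (ha' : a ≤ 1 / 2) (hm : 1 ≤ m) (hM : 1 ≤ M) (hB : 0 ≤ B)
    (hρB : ∀ ξ, ‖densityFourier ρ ξ‖ ≤ B * decayWeight a m ξ)
    (hd : ∀ s : ℤ, s ≠ 0 →
      ((P.filter fun q : ℕ => (q : ℤ) ∣ s).card : ℝ) ≤ D * (1 + |(s : ℝ)| / M))
    (hc0 : ∀ q ∈ P, c q 0 = 1) (hcs : ∀ q ∈ P, Summable fun m => ‖c q m‖)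
    (hcb : ∀ q ∈ P, ∀ m : ℤ, ‖c q m‖ ≤ C / (1 + w q * |(m : ℝ)|) ^ 5)
    (hw : ∀ q ∈ P, (q : ℝ) / M ≤ w q)
    (hh : ∀ q ∈ P, ∀ y : ℝ, HasSum (fun m : ℤ =>
      c q m * Complex.exp ((2 * Real.pi * m * y : ℝ) * Complex.I)) (h q y : ℂ))
    (hint : ∀ q ∈ P, Integrable fun x => ρ x * h q (q * x + t q)) (ξ : ℝ) :
    ‖densityFourier (fun x => ρ x * ((P.card : ℝ)⁻¹ * ∑ q ∈ P, h q (q * x + t q))) ξ -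
      densityFourier ρ ξ‖ ≤
      (P.card : ℝ)⁻¹ * (C * D * B * (2560 * (M ^ a * m ^ (1 - a) + m ^ 2 / M))) *
        decayWeight a M ξ := by
  classical
  have hcard : (0 : ℝ) < P.card := by exact_mod_cast hPne.card_pos
  have hm0 : 0 < m := by linarith
  have hM0 : 0 < M := by linarith
  set f : ℕ → ℤ → ℂ := fun q m => c q m * Complex.exp ((2 * Real.pi * m * t q : ℝ) * Complex.I) *
      densityFourier ρ (ξ - m * q) with hf
  have hf1 : ∀ q ∈ P, HasSum (fun m => if m = 0 then 0 else f q m)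
      (densityFourier (fun x => ρ x * h q (q * x + t q)) ξ - densityFourier ρ ξ) := by
    intro q hq
    have h1 := hasSum_densityFourier_mul hρ (hcs q hq) (hh q hq) q (t q) ξ
    -- The zeroth coefficient is 1, so dropping the term m = 0 subtracts exactly the transform of
    -- `ρ`.
    have h2 := h1.sub (hasSum_ite_eq (0 : ℤ) (densityFourier ρ ξ))
    refine h2.congr_fun fun m => ?_
    rcases eq_or_ne m 0 with rfl | hm
    · simp [hc0 q hq]
    · simp [hm, hf]
  have hsum := hasSum_sum hf1
  have e1 : densityFourier (fun x => ρ x * ((P.card : ℝ)⁻¹ * ∑ q ∈ P, h q (q * x + t q))) ξ -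
      densityFourier ρ ξ = (P.card : ℂ)⁻¹ * ∑ q ∈ P,
        (densityFourier (fun x => ρ x * h q (q * x + t q)) ξ - densityFourier ρ ξ) := by
    rw [Finset.sum_sub_distrib, Finset.sum_const, nsmul_eq_mul, mul_sub, ← mul_assoc,
      inv_mul_cancel₀ (by exact_mod_cast hcard.ne'), one_mul]
    congr 1
    simp only [densityFourier]
    rw [← integral_finsetSum _ fun q hq => integrable_density_mul_exp (hint q hq) ξ,
      ← integral_const_mul]
    congr 1 with x
    rw [← Finset.sum_mul]
    push_cast
    rw [← Finset.mul_sum]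
    ring
  rw [e1, norm_mul, norm_inv, Complex.norm_natCast, mul_assoc]
  refine mul_le_mul_of_nonneg_left ?_ (by positivity)
  set G : ℤ → ℝ := fun s => C / (1 + |(s : ℝ)| / M) ^ 5 * (B * decayWeight a m (ξ - s)) with hG
  have hG0 : ∀ s, 0 ≤ G s := fun s => by
    have := decayWeight_pos a (ξ - s) hm0
    positivity
  have hfG : ∀ q ∈ P, ∀ m : ℤ, ‖f q m‖ ≤ G (m * q) := fun q hq k => by
    rw [hf, hG]
    simp only [norm_mul, Complex.norm_exp_ofReal_mul_I, mul_one]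
    push_cast
    refine mul_le_mul ((hcb q hq k).trans ?_) (hρB _) (norm_nonneg _) (by positivity)
    have : |(k : ℝ) * q| / M ≤ w q * |(k : ℝ)| := by
      rw [abs_mul, Nat.abs_cast]
      calc |(k : ℝ)| * q / M = q / M * |(k : ℝ)| := by ring
        _ ≤ _ := by gcongr; exact hw q hq
    gcongr
  refine le_of_tendsto' hsum.norm fun S => ?_
  obtain ⟨T, hT⟩ := sum_mul_le_sum_dvd hG0 (S.erase 0) (Finset.notMem_erase 0 S) P hP hd
  calc ‖∑ m ∈ S, ∑ q ∈ P, if m = 0 then 0 else f q m‖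
      = ‖∑ m ∈ S.erase 0, ∑ q ∈ P, f q m‖ := by
        congr 1
        rw [← Finset.sum_erase S (a := 0) (by simp)]
        refine Finset.sum_congr rfl fun m hm => Finset.sum_congr rfl fun q _ => ?_
        rw [if_neg (Finset.ne_of_mem_erase hm)]
    _ ≤ ∑ m ∈ S.erase 0, ∑ q ∈ P, G (m * q) :=
        norm_sum_le_of_le _ fun m _ => norm_sum_le_of_le _ fun q hq => hfG q hq m
    -- The divisor count costs one factor 1 + |s|/M, lowering the fifth power in `G` to the fourth.
    _ ≤ ∑ s ∈ T, D * (1 + |(s : ℝ)| / M) * G s := hT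
    _ = C * D * B * ∑ s ∈ T, ((1 + |(s : ℝ)| / M) ^ 4)⁻¹ * decayWeight a m (ξ - s) := by
        rw [Finset.mul_sum]
        refine Finset.sum_congr rfl fun s _ => ?_
        have : 0 < 1 + |(s : ℝ)| / M := by positivity
        rw [hG]
        field_simp
    _ ≤ C * D * B * (2560 * (M ^ a * m ^ (1 - a) + m ^ 2 / M) * decayWeight a M ξ) := by
        gcongr
        exact sum_int_convolution_le ha ha' hm hM ξ T
    _ = _ := by ring

/-! ### Weak limits and infinite products of multipliers. -/

/-- Prokhorov compactness; an ultrafilter limit plays the role of a convergent subsequence. -/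
theorem exists_tendsto_of_compl_compact_eq_zero (ν : ℕ → ProbabilityMeasure ℝ) {K : Set ℝ}
    (hK : IsCompact K) (hν : ∀ k, (ν k : Measure ℝ) Kᶜ = 0) :
    ∃ (U : Ultrafilter ℕ) (μ : ProbabilityMeasure ℝ),
      (U : Filter ℕ) ≤ atTop ∧ Tendsto ν U (𝓝 μ) := by
  have ht : IsTightMeasureSet
      {((μ : ProbabilityMeasure ℝ) : Measure ℝ) | μ ∈ Set.range ν} := by
    rw [isTightMeasureSet_iff_exists_isCompact_measure_compl_le]
    rintro ε -
    refine ⟨K, hK, ?_⟩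
    rintro _ ⟨_, ⟨k, rfl⟩, rfl⟩
    rw [hν k]; exact zero_le
  have hc := isCompact_closure_of_isTightMeasureSet ht
  obtain ⟨μ, -, hμ⟩ := hc.ultrafilter_le_nhds' ((Ultrafilter.of atTop).map ν)
    (by
      rw [Ultrafilter.mem_map]
      exact Filter.univ_mem' fun k => subset_closure ⟨k, rfl⟩)
  exact ⟨Ultrafilter.of atTop, μ, Ultrafilter.of_le _, hμ⟩

/-- The probability measure with density proportional to a continuous function. -/
theorem exists_probabilityMeasure_of_density {ρ : ℝ → ℝ} (hc : Continuous ρ) (h0 : ∀ x, 0 ≤ ρ x)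
    (hi : Integrable ρ) {I : ℝ} (hI : ∫ x, ρ x = I) (hI0 : 0 < I) :
    ∃ ν : ProbabilityMeasure ℝ, (∀ S : Set ℝ, (∀ x, ρ x ≠ 0 → x ∈ S) → MeasurableSet S →
      (ν : Measure ℝ) Sᶜ = 0) ∧
      ∀ ξ, measureFourier ν ξ = (I : ℂ)⁻¹ * densityFourier ρ ξ := by
  set g : ℝ → NNReal := fun x => Real.toNNReal (I⁻¹ * ρ x) with hg
  have hgm : Measurable g := (measurable_const.mul hc.measurable).real_toNNReal
  have hgr : ∀ x, (g x : ℝ) = I⁻¹ * ρ x := fun x =>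
    Real.coe_toNNReal _ (mul_nonneg (inv_nonneg.2 hI0.le) (h0 x))
  set ν : Measure ℝ := volume.withDensity fun x => (g x : ENNReal) with hν
  have hp : IsProbabilityMeasure ν := ⟨by
    rw [hν, withDensity_apply _ MeasurableSet.univ, Measure.restrict_univ]
    have h1 : ∫⁻ x, (g x : ENNReal) = ENNReal.ofReal (∫ x, I⁻¹ * ρ x) := by
      rw [ofReal_integral_eq_lintegral_ofReal (hi.const_mul _)
        (ae_of_all _ fun x => mul_nonneg (inv_nonneg.2 hI0.le) (h0 x))]
      rfl
    rw [h1, integral_const_mul, hI, inv_mul_cancel₀ hI0.ne', ENNReal.ofReal_one]⟩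
  refine ⟨⟨ν, hp⟩, fun S hS hSm => ?_, fun ξ => ?_⟩
  · show ν Sᶜ = 0
    rw [hν, withDensity_apply _ hSm.compl, setLIntegral_congr_fun (g := fun _ => 0) hSm.compl]
    · simp
    · intro x hx
      have : ρ x = 0 := by
        by_contra h
        exact hx (hS x h)
      simp [hg, this]
  · show measureFourier ν ξ = _
    rw [measureFourier, hν, integral_withDensity_eq_integral_smul hgm, densityFourier,
      ← integral_const_mul]
    congr 1 with x
    rw [NNReal.smul_def, hgr, Complex.real_smul]
    push_cast
    ring

theorem tendsto_measureFourier {ι : Type*} {L : Filter ι} {ν : ι → ProbabilityMeasure ℝ}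
    {μ : ProbabilityMeasure ℝ} (h : Tendsto ν L (𝓝 μ)) (ξ : ℝ) :
    Tendsto (fun k => measureFourier (ν k) ξ) L (𝓝 (measureFourier μ ξ)) := by
  rw [ProbabilityMeasure.tendsto_iff_forall_integral_rclike_tendsto ℂ] at h
  exact h (BoundedContinuousFunction.ofNormedAddCommGroup
    (fun x : ℝ => Complex.exp (-(2 * Real.pi * ξ * x : ℝ) * Complex.I)) (by fun_prop) 1
    fun x => (norm_exp_neg_ofReal_mul_I _).le)

/-- A weak limit of densities with uniform Fourier decay. -/
theorem supportsFourierDecay_of_densities {ρ : ℕ → ℝ → ℝ} {K : ℕ → Set ℝ} {A a : ℝ}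
    (hc : ∀ k, Continuous (ρ k)) (h0 : ∀ k x, 0 ≤ ρ k x) (hK : ∀ k, IsCompact (K k))
    (hKa : Antitone K) (hsupp : ∀ k x, ρ k x ≠ 0 → x ∈ K k)
    (hmass : ∀ k, 1 / 2 ≤ ∫ x, ρ k x)
    (hdec : ∀ k ξ, ξ ≠ 0 → ‖densityFourier (ρ k) ξ‖ ≤ A * |ξ| ^ (-a)) :
    SupportsFourierDecay (⋂ k, K k) (2 * a) := by
  have hi : ∀ k, Integrable (ρ k) := fun k =>
    (hc k).integrable_of_hasCompactSupport
      (HasCompactSupport.of_support_subset_isCompact (hK k) fun x hx => hsupp k x hx)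
  choose ν hν hνF using fun k => exists_probabilityMeasure_of_density (hc k) (h0 k) (hi k) rfl
    (lt_of_lt_of_le (by norm_num) (hmass k))
  have hνK : ∀ j k, j ≤ k → (ν k : Measure ℝ) (K j)ᶜ = 0 := fun j k hjk =>
    hν k (K j) (fun x hx => hKa hjk (hsupp k x hx)) (hK j).measurableSet
  obtain ⟨U, μ, hU, hμ⟩ := exists_tendsto_of_compl_compact_eq_zero ν (hK 0)
    fun k => hνK 0 k (Nat.zero_le k)
  have hcl : IsClosed (⋂ k, K k) := isClosed_iInter fun k => (hK k).isClosed
  refine ⟨μ, ⋂ k, K k, 2 * A, μ.2, (hK 0).of_isClosed_subset hcl (Set.iInter_subset _ 0),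
    subset_rfl, ?_, fun ξ hξ => ?_⟩
  · rw [Set.compl_iInter, measure_iUnion_null_iff]
    intro j
    -- On an open set the limit has at most the liminf of the masses, and `ν k` gives none to the
    -- complement of `K j` once k ≥ j.
    have h1 := ProbabilityMeasure.le_liminf_measure_open_of_tendsto hμ (hK j).isClosed.isOpen_compl
    have h2 : (fun k => (ν k : Measure ℝ) (K j)ᶜ) =ᶠ[(U : Filter ℕ)] fun _ => 0 := by
      filter_upwards [hU (eventually_ge_atTop j)] with k hk using hνK j k hk
    rw [liminf_congr h2, liminf_const] at h1
    exact le_antisymm h1 zero_le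
  · refine le_of_tendsto (tendsto_measureFourier hμ ξ).norm (Eventually.of_forall fun k => ?_)
    have hm := hmass k
    have hm0 : 0 < ∫ x, ρ k x := by linarith
    have h1 : (∫ x, ρ k x)⁻¹ ≤ 2 := by
      rw [inv_le_comm₀ hm0 (by norm_num)]; linarith
    have h2 := hdec k ξ hξ
    rw [hνF k ξ, norm_mul, norm_inv, Complex.norm_real, Real.norm_of_nonneg hm0.le,
      show -(2 * a) / 2 = -a by ring]
    calc _ ≤ 2 * (A * |ξ| ^ (-a)) := by gcongr
      _ = _ := by ring

theorem decayWeight_mono_scale (a t : ℝ) {m M : ℝ} (hm : 0 < m) (hmM : m ≤ M) :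
    decayWeight a m t ≤ decayWeight a M t := by
  unfold decayWeight
  have : |t| / M ≤ |t| / m := by gcongr
  have hM : 0 < M := hm.trans_le hmM
  gcongr

theorem decayWeight_le_rpow {a m t : ℝ} (ha : 0 ≤ a) (hm : 0 < m) (ht : t ≠ 0) :
    decayWeight a m t ≤ |t| ^ (-a) := by
  have h1 : ((1 + |t| / m) ^ 2)⁻¹ ≤ 1 :=
    inv_le_one_of_one_le₀ (one_le_pow₀ (le_add_of_nonneg_right (by positivity)))
  have h2 : (1 + |t|) ^ (-a) ≤ |t| ^ (-a) :=
    Real.rpow_le_rpow_of_nonpos (abs_pos.2 ht) (by linarith) (by linarith)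
  calc decayWeight a m t ≤ (1 + |t|) ^ (-a) * 1 := by
        unfold decayWeight; gcongr
    _ ≤ _ := by rw [mul_one]; exact h2

theorem decayWeight_zero (a m : ℝ) : decayWeight a m 0 = 1 := by simp [decayWeight]

theorem densityFourier_zero (ρ : ℝ → ℝ) : densityFourier ρ 0 = ((∫ x, ρ x : ℝ) : ℂ) := by
  simp only [densityFourier, mul_zero, zero_mul, Complex.ofReal_zero, neg_zero, Complex.exp_zero,
    mul_one]
  exact integral_complex_ofReal

/-- An infinite product of multipliers, each of which perturbs the Fourier transform of a density
that is smooth at scale `1 / m k` by a summable amount. -/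
theorem supportsFourierDecay_of_multipliers {ρ₀ : ℝ → ℝ} {K₀ : Set ℝ} {F : ℕ → ℝ → ℝ}
    {E : ℕ → Set ℝ} {m : ℕ → ℝ} {a B δ : ℝ} (ha : 0 ≤ a)
    (hm0 : ∀ k, 0 < m k) (hm : ∀ k, m k ≤ m (k + 1)) (hB : 0 < B) (hδ : δ ≤ 1 / 4)
    (hδB : 8 * B * δ ≤ 1)
    (hρc : Continuous ρ₀) (hρ0 : ∀ x, 0 ≤ ρ₀ x) (hρi : ∫ x, ρ₀ x = 1) (hK₀ : IsCompact K₀)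
    (hρs : ∀ x, ρ₀ x ≠ 0 → x ∈ K₀) (hρd : ∀ ξ, ‖densityFourier ρ₀ ξ‖ ≤ B * decayWeight a (m 0) ξ)
    (hFc : ∀ k, Continuous (F k)) (hF0 : ∀ k x, 0 ≤ F k x) (hE : ∀ k, IsClosed (E k))
    (hFs : ∀ k x, F k x ≠ 0 → x ∈ E k)
    (hstep : ∀ (k : ℕ) (ρ : ℝ → ℝ) (B' : ℝ), Continuous ρ → HasCompactSupport ρ → 0 ≤ B' →
      (∀ ξ, ‖densityFourier ρ ξ‖ ≤ B' * decayWeight a (m k) ξ) →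
      ∀ ξ, ‖densityFourier (fun x => ρ x * F k x) ξ - densityFourier ρ ξ‖ ≤
        B' * (δ * (1 / 2) ^ k) * decayWeight a (m (k + 1)) ξ) :
    SupportsFourierDecay (K₀ ∩ ⋂ k, E k) (2 * a) := by
  set ρ : ℕ → ℝ → ℝ := fun k x => ρ₀ x * ∏ j ∈ Finset.range k, F j x with hρ
  set K : ℕ → Set ℝ := fun k => K₀ ∩ ⋂ j ∈ Finset.range k, E j with hK
  have hsucc : ∀ k, ρ (k + 1) = fun x => ρ k x * F k x := fun k => by
    funext x; simp only [hρ, Finset.prod_range_succ, mul_assoc]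
  have hc : ∀ k, Continuous (ρ k) := fun k =>
    hρc.mul (continuous_finsetProd _ fun j _ => hFc j)
  have h0 : ∀ k x, 0 ≤ ρ k x := fun k x =>
    mul_nonneg (hρ0 x) (Finset.prod_nonneg fun j _ => hF0 j x)
  have hKc : ∀ k, IsCompact (K k) := fun k =>
    hK₀.inter_right (isClosed_biInter fun j _ => hE j)
  have hsupp : ∀ k x, ρ k x ≠ 0 → x ∈ K k := fun k x hx => by
    refine ⟨hρs x (left_ne_zero_of_mul hx), Set.mem_iInter₂.2 fun j hj => hFs j x ?_⟩
    exact Finset.prod_ne_zero_iff.1 (right_ne_zero_of_mul hx) j hj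
  have hcs : ∀ k, HasCompactSupport (ρ k) := fun k =>
    HasCompactSupport.of_support_subset_isCompact (hKc k) fun x hx => hsupp k x hx
  have hKa : Antitone K := fun i j hij x hx =>
    ⟨hx.1, Set.mem_iInter₂.2 fun l hl => Set.mem_iInter₂.1 hx.2 l
      (Finset.range_mono hij hl)⟩
  have hp : ∀ k : ℕ, (0 : ℝ) < (1 / 2) ^ k := fun k => by positivity
  -- The constant climbs from B towards 2B; step k may add B (1/2)^(k+1), which δ ≤ 1/4 ensures.
  have hbound : ∀ k ξ, ‖densityFourier (ρ k) ξ‖ ≤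
      B * (2 - (1 / 2) ^ k) * decayWeight a (m k) ξ := by
    intro k
    induction k with
    | zero => intro ξ; simpa [hρ, show (2 : ℝ) - 1 = 1 by norm_num] using hρd ξ
    | succ k ih =>
      intro ξ
      have hp1 : (1 / 2 : ℝ) ^ k ≤ 1 := pow_le_one₀ (by norm_num) (by norm_num)
      have hBk : 0 ≤ B * (2 - (1 / 2) ^ k) := mul_nonneg hB.le (by linarith)
      have h1 := hstep k (ρ k) _ (hc k) (hcs k) hBk ih ξ
      rw [← hsucc] at h1
      have h2 := (ih ξ).trans
        (mul_le_mul_of_nonneg_left (decayWeight_mono_scale a ξ (hm0 k) (hm k)) hBk)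
      have h3 := norm_le_norm_add_norm_sub' (densityFourier (ρ (k + 1)) ξ) (densityFourier (ρ k) ξ)
      have hW := decayWeight_pos a ξ (hm0 (k + 1))
      have h4 : B * (2 - (1 / 2) ^ k) * (δ * (1 / 2) ^ k) ≤ B * ((1 / 2) ^ k / 2) := by
        have : (2 - (1 / 2) ^ k) * (δ * (1 / 2) ^ k) ≤ 2 * (1 / 4 * (1 / 2) ^ k) := by
          have e1 : δ * (1 / 2) ^ k ≤ 1 / 4 * (1 / 2) ^ k :=
            mul_le_mul_of_nonneg_right hδ (hp k).le
          have e2 : 0 ≤ (1 / 4 : ℝ) * (1 / 2) ^ k := by positivity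
          nlinarith [hp k]
        nlinarith
      have h5 := mul_le_mul_of_nonneg_right h4 hW.le
      calc _ ≤ B * (2 - (1 / 2) ^ k) * decayWeight a (m (k + 1)) ξ +
            B * ((1 / 2) ^ k / 2) * decayWeight a (m (k + 1)) ξ := by linarith
        _ = _ := by rw [pow_succ]; ring
  -- The mass is the transform at 0, and 8Bδ ≤ 1 bounds its drift at step k by (1/2)^k / 4, so it
  -- never falls below 1/2.
  have hmass : ∀ k, |(∫ x, ρ k x) - 1| ≤ 1 / 2 * (1 - (1 / 2) ^ k) := by
    intro k
    induction k with
    | zero => simp [hρ, hρi]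
    | succ k ih =>
      have hp1 : (1 / 2 : ℝ) ^ k ≤ 1 := pow_le_one₀ (by norm_num) (by norm_num)
      have hBk : 0 ≤ B * (2 - (1 / 2) ^ k) := mul_nonneg hB.le (by linarith)
      have h1 := hstep k (ρ k) _ (hc k) (hcs k) hBk (hbound k) 0
      rw [← hsucc, decayWeight_zero, mul_one, densityFourier_zero, densityFourier_zero,
        ← Complex.ofReal_sub, Complex.norm_real, Real.norm_eq_abs] at h1
      have h2 := abs_sub_le (∫ x, ρ (k + 1) x) (∫ x, ρ k x) 1
      have h3 : B * (2 - (1 / 2) ^ k) * (δ * (1 / 2) ^ k) ≤ (1 / 2) ^ k / 4 := by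
        have e1 : B * δ * (1 / 2) ^ k ≤ 1 / 8 * (1 / 2) ^ k :=
          mul_le_mul_of_nonneg_right (by linarith) (hp k).le
        have e2 : 0 ≤ (1 / 8 : ℝ) * (1 / 2) ^ k := by positivity
        nlinarith [hp k]
      rw [pow_succ]
      linarith
  have hinter : ⋂ k, K k = K₀ ∩ ⋂ k, E k := by
    ext x
    simp only [hK, Set.mem_iInter, Set.mem_inter_iff]
    exact ⟨fun h => ⟨(h 0).1, fun k => (h (k + 1)).2 k (Finset.self_mem_range_succ k)⟩,
      fun h k => ⟨h.1, fun j _ => h.2 j⟩⟩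
  rw [← hinter]
  refine supportsFourierDecay_of_densities (A := B * 2) hc h0 hKc hKa hsupp (fun k => ?_)
    fun k ξ hξ => (hbound k ξ).trans ?_
  · have h1 := (abs_le.1 (hmass k)).1
    linarith [hp k]
  · have h1 := decayWeight_le_rpow ha (hm0 k) hξ
    have h2 := decayWeight_pos a ξ (hm0 k)
    have h3 : B * (2 - (1 / 2) ^ k) ≤ B * 2 := by nlinarith [hp k]
    gcongr

/-! ### Diophantine exponents and separation of shifted fractions. -/

/-- Rounding qθ gives, for every q, an approximation within 1/(2q), so no g < 1 leaves only finitely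
many solutions. -/
theorem one_le_of_hasDiophantineExponent {θ γ : ℝ} (h : HasDiophantineExponent θ γ) : 1 ≤ γ := by
  refine h.2 fun g hg => ?_
  by_contra! hlt
  refine Set.infinite_of_injective_forall_mem
    (f := fun n : ℕ => (round (((n + 1 : ℕ) : ℝ) * θ), n + 1))
    (fun a b hab => by simpa using (Prod.ext_iff.1 hab).2) (fun n => ?_) hg
  have hn : (1 : ℝ) ≤ ((n + 1 : ℕ) : ℝ) := by exact_mod_cast Nat.le_add_left 1 n
  refine ⟨Nat.succ_pos n, ?_⟩
  set q : ℝ := ((n + 1 : ℕ) : ℝ) with hq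
  have hq0 : 0 < q := by linarith
  have h1 : |q * θ - round (q * θ)| ≤ 1 / 2 := abs_sub_round _
  have e : θ - (round (q * θ) : ℝ) / q = (q * θ - round (q * θ)) / q := by field_simp
  show |θ - (round (q * θ) : ℝ) / q| ≤ q ^ (-g)
  rw [e, abs_div, abs_of_pos hq0]
  calc _ ≤ 1 / q := by gcongr; linarith
    _ = q ^ (-1 : ℝ) := by rw [Real.rpow_neg_one, one_div]
    _ ≤ _ := Real.rpow_le_rpow_of_exponent_le hn (by linarith)

theorem exists_pos_le_of_finite {α : Type*} {S : Set α} (hS : S.Finite) {f : α → ℝ}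
    (hf : ∀ x ∈ S, 0 < f x) : ∃ c : ℝ, 0 < c ∧ ∀ x ∈ S, c ≤ f x := by
  have h : ∀ᶠ c in 𝓝[>] (0 : ℝ), ∀ x ∈ S, c ≤ f x :=
    (eventually_all_finite hS).2 fun x hx =>
      Filter.Eventually.filter_mono nhdsWithin_le_nhds (eventually_le_nhds (hf x hx))
  obtain ⟨c, h1, h2⟩ := (h.and self_mem_nhdsWithin).exists
  exact ⟨c, h2, h1⟩

/-- Some exponent below g has only finitely many exceptions, and irrationality keeps each of them at
positive distance; the constant absorbs them. -/
theorem exists_diophantine_lower_bound {θ γ g : ℝ} (hθ : Irrational θ)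
    (h : HasDiophantineExponent θ γ) (hg : γ < g) :
    ∃ c : ℝ, 0 < c ∧ ∀ (p : ℤ) (n : ℕ), 0 < n → c * (n : ℝ) ^ (-g) ≤ |θ - p / n| := by
  obtain ⟨g', hg', hlt⟩ := (isGLB_lt_iff h).1 hg
  have hpos : ∀ x : ℤ × ℕ, 0 < |θ - (x.1 : ℝ) / (x.2 : ℝ)| := fun x => by
    rw [abs_pos, sub_ne_zero]
    exact_mod_cast hθ.ne_rat ((x.1 : ℚ) / (x.2 : ℚ))
  obtain ⟨c, hc, hcS⟩ := exists_pos_le_of_finite hg' fun x _ => hpos x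
  refine ⟨min c 1, lt_min hc one_pos, fun p n hn => ?_⟩
  have hn1 : (1 : ℝ) ≤ n := by exact_mod_cast hn
  have h1 : (n : ℝ) ^ (-g) ≤ 1 :=
    Real.rpow_le_one_of_one_le_of_nonpos hn1 (by
      have := one_le_of_hasDiophantineExponent h
      linarith)
  have h0 : 0 < (n : ℝ) ^ (-g) := by positivity
  by_cases hmem : |θ - (p : ℝ) / (n : ℝ)| ≤ (n : ℝ) ^ (-g')
  · have := hcS (p, n) ⟨hn, hmem⟩
    calc _ ≤ c * 1 := by gcongr; exact min_le_left _ _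
      _ ≤ _ := by simpa using this
  · push Not at hmem
    calc _ ≤ 1 * (n : ℝ) ^ (-g) := by gcongr; exact min_le_right _ _
      _ ≤ (n : ℝ) ^ (-g') := by
          rw [one_mul]; exact Real.rpow_le_rpow_of_exponent_le hn1 (by linarith)
      _ ≤ _ := hmem.le

/-- Distinct shifted reduced fractions are separated. -/
theorem exists_separation {θ γ g : ℝ}
    (hθ : (θ = 0 ∧ γ = 1) ∨ (Irrational θ ∧ HasDiophantineExponent θ γ)) (hg : γ < g) :
    ∃ c : ℝ, 0 < c ∧ ∀ (r r' : ℤ) (q q' : ℕ), 0 < q → q ≤ q' → IsCoprime r (q : ℤ) →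
      IsCoprime r' (q' : ℤ) → (r, q) ≠ (r', q') →
      c * (q' : ℝ) ^ (-g) / q ≤ |((r : ℝ) - θ) / q - ((r' : ℝ) - θ) / q'| := by
  rcases hθ with ⟨rfl, rfl⟩ | ⟨hirr, hdio⟩
  · refine ⟨1, one_pos, fun r r' q q' hq hqq hr hr' hne => ?_⟩
    have hq0 : (0 : ℝ) < q := by exact_mod_cast hq
    have hq1 : (1 : ℝ) ≤ q' := by exact_mod_cast hq.trans_le hqq
    have hq'0 : (0 : ℝ) < q' := by linarith
    have hz : r * q' - r' * q ≠ 0 := by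
      intro h0
      have h0' : r * (q' : ℤ) = r' * q := sub_eq_zero.1 h0
      have d1 : (q : ℤ) ∣ q' := hr.symm.dvd_of_dvd_mul_left (h0' ▸ Dvd.intro_left _ rfl)
      have d2 : (q' : ℤ) ∣ q := hr'.symm.dvd_of_dvd_mul_left (h0' ▸ Dvd.intro_left _ rfl)
      have hqe : q = q' := Nat.dvd_antisymm (Int.natCast_dvd_natCast.1 d1)
        (Int.natCast_dvd_natCast.1 d2)
      subst hqe
      exact hne (Prod.ext (mul_right_cancel₀ (by exact_mod_cast hq.ne') h0') rfl)
    have h1 : (1 : ℝ) ≤ |(r : ℝ) * q' - r' * q| := by exact_mod_cast Int.one_le_abs hz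
    have e : ((r : ℝ) - 0) / q - ((r' : ℝ) - 0) / q' = (r * q' - r' * q) / (q * q') := by
      field_simp; ring
    rw [e, abs_div, abs_of_pos (mul_pos hq0 hq'0), one_mul]
    calc (q' : ℝ) ^ (-g) / q ≤ (q' : ℝ) ^ (-1 : ℝ) / q := by
          gcongr
      _ = 1 / (q * q') := by rw [Real.rpow_neg_one]; field_simp
      _ ≤ _ := by gcongr
  · have hg1 : 1 < g := (one_le_of_hasDiophantineExponent hdio).trans_lt hg
    obtain ⟨c, hc, hcb⟩ := exists_diophantine_lower_bound hirr hdio hg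
    refine ⟨min c 1, lt_min hc one_pos, fun r r' q q' hq hqq hr hr' hne => ?_⟩
    have hq0 : (0 : ℝ) < q := by exact_mod_cast hq
    have hq1 : (1 : ℝ) ≤ q' := by exact_mod_cast hq.trans_le hqq
    have hq'0 : (0 : ℝ) < q' := by linarith
    rcases hqq.eq_or_lt with rfl | hlt
    · have hz : r - r' ≠ 0 := fun h0 => hne (by rw [sub_eq_zero.1 h0])
      have h1 : (1 : ℝ) ≤ |(r : ℝ) - r'| := by exact_mod_cast Int.one_le_abs hz
      have e : ((r : ℝ) - θ) / q - ((r' : ℝ) - θ) / q = (r - r') / q := by ring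
      rw [e, abs_div, abs_of_pos hq0]
      gcongr
      calc min c 1 * (q : ℝ) ^ (-g) ≤ 1 * 1 := by
            gcongr
            · exact min_le_right _ _
            · exact Real.rpow_le_one_of_one_le_of_nonpos hq1 (by linarith)
        _ ≤ _ := by linarith
    · obtain ⟨n, rfl⟩ := Nat.exists_eq_add_of_lt hlt
      set k : ℕ := n + 1 with hk
      have hqk : q + n + 1 = q + k := by omega
      rw [hqk] at hq'0 hq1 ⊢
      have hk0 : (0 : ℝ) < k := by exact_mod_cast Nat.succ_pos n
      have hkq : (k : ℝ) ≤ ((q + k : ℕ) : ℝ) := by push_cast; linarith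
      -- With k = q' - q, the difference of the two shifted fractions is -(θ - p/k) · k/(qq'), so
      -- approximating θ by p/k controls it. Since k ≤ q' and g > 1, the resulting k^(1-g) is at
      -- least q'^(1-g).
      set p : ℤ := r * (q + k : ℕ) - r' * q with hp
      have e : ((r : ℝ) - θ) / q - ((r' : ℝ) - θ) / ((q + k : ℕ) : ℝ) =
          -((θ - p / k) * (k / (q * ((q + k : ℕ) : ℝ)))) := by
        rw [hp]; push_cast at hq'0 ⊢; field_simp; ring
      rw [e, abs_neg, abs_mul, abs_of_pos (a := (k : ℝ) / _) (by positivity)]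
      set Q : ℝ := ((q + k : ℕ) : ℝ) with hQ
      calc min c 1 * Q ^ (-g) / q ≤ c * Q ^ (-g) / q := by gcongr; exact min_le_left _ _
        _ = c * Q ^ (1 - g) / (q * Q) := by
            rw [sub_eq_add_neg, Real.rpow_add hq'0, Real.rpow_one]; field_simp
        _ ≤ c * (k : ℝ) ^ (1 - g) / (q * Q) := by
            have := Real.rpow_le_rpow_of_nonpos hk0 hkq (by linarith : 1 - g ≤ 0)
            gcongr
        _ = c * (k : ℝ) ^ (-g) * (k / (q * Q)) := by
            rw [sub_eq_add_neg, Real.rpow_add hk0, Real.rpow_one]; ring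
        _ ≤ _ := by gcongr; exact hcb p k (Nat.succ_pos n)

/-! ### Orders of decay and the window criterion for tightness. -/

theorem eventually_rpow_bounds_of_hasOrder {ψ : ℕ → ℝ} {τ ε : ℝ} (hpos : ∀ q, 1 ≤ q → 0 < ψ q)
    (h : HasOrder ψ τ) (hε : 0 < ε) :
    ∀ᶠ q : ℕ in atTop, (q : ℝ) ^ (-(τ + ε)) ≤ ψ q ∧ ψ q ≤ (q : ℝ) ^ (-(τ - ε)) := by
  have h1 := (Metric.tendsto_nhds.1 h) ε hε
  filter_upwards [h1, eventually_ge_atTop 2] with q hq hq2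
  rw [Real.dist_eq, abs_lt] at hq
  have hq1 : (1 : ℝ) < q := by exact_mod_cast hq2
  have hlog : 0 < Real.log q := Real.log_pos hq1
  have hψ := hpos q (by omega)
  set u := Real.log (ψ q) / Real.log q with hu
  have e : Real.log (ψ q) = u * Real.log q := by rw [hu]; field_simp
  have e2 : ψ q = (q : ℝ) ^ u := by
    rw [Real.rpow_def_of_pos (by linarith), mul_comm, ← e, Real.exp_log hψ]
  rw [e2]
  exact ⟨Real.rpow_le_rpow_of_exponent_le hq1.le (by linarith [hq.2]),
    Real.rpow_le_rpow_of_exponent_le hq1.le (by linarith [hq.1])⟩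

theorem finite_bounded_pairs (φ : ℕ → ℝ) (θ x X : ℝ) :
    {rq : ℤ × ℕ | 0 < rq.2 ∧ (rq.2 : ℝ) < X ∧
      |x - ((rq.1 : ℝ) - θ) / (rq.2 : ℝ)| ≤ φ rq.2}.Finite := by
  have hsub : {rq : ℤ × ℕ | 0 < rq.2 ∧ (rq.2 : ℝ) < X ∧
      |x - ((rq.1 : ℝ) - θ) / (rq.2 : ℝ)| ≤ φ rq.2} ⊆
      ⋃ q ∈ Finset.range ⌈X⌉₊, (fun r : ℤ => (r, q)) ''
        (Set.Icc ⌈q * x + θ - q * φ q⌉ ⌊q * x + θ + q * φ q⌋) := by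
    rintro ⟨r, q⟩ ⟨hq, hqX, h⟩
    simp only at hq hqX h
    have hq0 : (0 : ℝ) < q := by exact_mod_cast hq
    refine Set.mem_iUnion₂.2 ⟨q, Finset.mem_range.2 (Nat.lt_ceil.2 hqX), r, ?_, rfl⟩
    have e : x - ((r : ℝ) - θ) / q = (q * x + θ - r) / q := by field_simp; ring
    rw [e, abs_div, abs_of_pos hq0, div_le_iff₀ hq0, abs_le] at h
    rw [Set.mem_Icc, Int.ceil_le, Int.le_floor]
    constructor <;> linarith [h.1, h.2]
  exact ((Finset.range ⌈X⌉₊).finite_toSet.biUnion fun q _ =>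
    (Set.finite_Icc _ _).image _).subset hsub

/-- A criterion for membership in `Tight`: for every `k` a good approximation, such that no other
pair with denominator in the `k`-th window approximates within `ψ₁`. -/
theorem mem_tight_of_windows {ψ₁ ψ₂ : ℕ → ℝ} {θ x : ℝ} (hψ₂ : ∀ q, 1 ≤ q → 0 < ψ₂ q) {L : ℕ → ℝ}
    (hL : Tendsto L atTop atTop) {r : ℕ → ℤ} {q : ℕ → ℕ} (hq0 : ∀ k, 0 < q k)
    (hq : Tendsto q atTop atTop) (hcop : ∀ k, IsCoprime (r k) (q k : ℤ))
    (hlow : ∀ k, ψ₁ (q k) - ψ₂ (q k) / (k + 1) ≤ x - ((r k : ℝ) - θ) / q k)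
    (hnn : ∀ k, 0 ≤ x - ((r k : ℝ) - θ) / q k)
    (hup : ∀ k, x - ((r k : ℝ) - θ) / q k ≤ ψ₁ (q k))
    (hwin : ∀ (k : ℕ) (r' : ℤ) (q' : ℕ), 0 < q' → IsCoprime r' (q' : ℤ) → L k ≤ q' →
      (q' : ℝ) < L (k + 1) → (r', q') ≠ (r k, q k) →
      ψ₁ (q k) + ψ₁ q' < |((r k : ℝ) - θ) / q k - ((r' : ℝ) - θ) / q'|) :
    x ∈ Tight ψ₁ ψ₂ θ := by
  constructor
  · intro hfin
    have hb : (Prod.snd '' approxPairs ψ₁ θ x).Finite := hfin.image _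
    obtain ⟨b, hb⟩ := hb.bddAbove
    obtain ⟨k, hk⟩ := (hq.eventually (eventually_gt_atTop b)).exists
    have : (r k, q k) ∈ approxPairs ψ₁ θ x :=
      ⟨hq0 k, hcop k, abs_le.2 ⟨by linarith [hnn k, hup k], hup k⟩⟩
    exact absurd (hb ⟨_, this, rfl⟩) (not_le.2 hk)
  · intro c hc
    obtain ⟨K, hK⟩ := exists_nat_one_div_lt hc
    -- beyond the window containing `K` only the chosen pairs could occur
    obtain ⟨X, hX⟩ : ∃ X : ℝ, ∀ k < K, L k ≤ X ∧ L (k + 1) ≤ X := by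
      have h1 := (Finset.range (K + 1)).finite_toSet.image L
      obtain ⟨X, hX⟩ := h1.bddAbove
      refine ⟨X, fun k hk => ⟨hX ⟨k, ?_, rfl⟩, hX ⟨k + 1, ?_, rfl⟩⟩⟩ <;>
        simp only [Finset.coe_range, Set.mem_Iio] <;> omega
    refine (finite_bounded_pairs (fun q => ψ₁ q - c * ψ₂ q) θ x (max X (L 0))).subset ?_
    rintro ⟨r', q'⟩ ⟨hq', hcop', happ⟩
    refine ⟨hq', ?_, happ⟩
    simp only at hq' hcop' happ ⊢
    by_contra! hge
    have hge0 : L 0 ≤ q' := (le_max_right _ _).trans hge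
    have hgeX : X ≤ q' := (le_max_left _ _).trans hge
    have hex : ∃ k, (q' : ℝ) < L (k + 1) := by
      have := ((tendsto_add_atTop_iff_nat 1).2 hL).eventually (eventually_gt_atTop (q' : ℝ))
      exact this.exists
    classical
    set k := Nat.find hex with hkdef
    have hk1 : (q' : ℝ) < L (k + 1) := Nat.find_spec hex
    have hk0 : L k ≤ q' := by
      rcases Nat.eq_zero_or_pos k with h0 | h0
      · rw [h0]; exact hge0
      · have := Nat.find_min hex (m := k - 1) (by omega)
        rw [Nat.sub_add_cancel h0] at this
        exact not_lt.1 this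
    have hkK : K ≤ k := by
      by_contra! hlt
      linarith [(hX k hlt).2]
    have hψ' := hψ₂ q' hq'
    have hcpos : 0 < c * ψ₂ q' := mul_pos hc hψ'
    -- The chosen pair fails the sharpened inequality because 1/(k+1) < c; any other pair is
    -- excluded by the triangle inequality and the window separation.
    by_cases heq : (r', q') = (r k, q k)
    · have hr : r' = r k := (Prod.ext_iff.1 heq).1
      have hqe : q' = q k := (Prod.ext_iff.1 heq).2
      rw [hr, hqe] at happ
      have hψk := hψ₂ (q k) (hq0 k)
      have h1 := (abs_le.1 happ).2
      have h2 := hlow k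
      have h3 : ψ₂ (q k) / (k + 1) < c * ψ₂ (q k) := by
        have : (1 : ℝ) / (k + 1) ≤ 1 / (K + 1) := by
          have : (K : ℝ) ≤ k := by exact_mod_cast hkK
          gcongr
        have h5 : (1 : ℝ) / (k + 1) < c := by linarith
        calc ψ₂ (q k) / (k + 1) = 1 / (k + 1) * ψ₂ (q k) := by ring
          _ < _ := by gcongr
      linarith
    · have h1 := hwin k r' q' hq' hcop' hk0 hk1 heq
      have h2 : |((r k : ℝ) - θ) / q k - ((r' : ℝ) - θ) / q'| ≤
          |x - ((r k : ℝ) - θ) / q k| + |x - ((r' : ℝ) - θ) / q'| := by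
        have := abs_sub_le (((r k : ℝ) - θ) / q k) x (((r' : ℝ) - θ) / q')
        rwa [abs_sub_comm _ x] at this
      have h3 : |x - ((r k : ℝ) - θ) / q k| ≤ ψ₁ (q k) :=
        abs_le.2 ⟨by linarith [hnn k, hup k], hup k⟩
      linarith

/-! ### The multipliers, the windows and the exponents. -/

/-- `F` is chosen before `a`, `m`, `B` and `ρ`, so it can be fixed at each level before the partial
products exist; `C` is the same for all levels. -/
theorem exists_multiplier : ∃ C : ℝ, 0 < C ∧ ∀ (P : Finset ℕ) (Y M D : ℝ) (t w : ℕ → ℝ),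
    P.Nonempty → (∀ q ∈ P, q.Prime ∧ Y < q) → 0 < Y → 1 ≤ Real.log Y → 1 ≤ M → 1 ≤ D →
    Real.log M ≤ D * Real.log Y → (∀ q ∈ P, (q : ℝ) / M ≤ w q) →
    ∃ F : ℝ → ℝ, Continuous F ∧ (∀ x, 0 ≤ F x) ∧
      (∀ x, F x ≠ 0 → ∃ q ∈ P, ∃ n : ℤ, |q * x + t q - n| ≤ w q) ∧
      ∀ (a m B : ℝ) (ρ : ℝ → ℝ), 0 ≤ a → a ≤ 1 / 2 → 1 ≤ m → 0 ≤ B → Continuous ρ →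
        HasCompactSupport ρ → (∀ ξ, ‖densityFourier ρ ξ‖ ≤ B * decayWeight a m ξ) →
        ∀ ξ, ‖densityFourier (fun x => ρ x * F x) ξ - densityFourier ρ ξ‖ ≤
          (P.card : ℝ)⁻¹ * (C * D * B * (2560 * (M ^ a * m ^ (1 - a) + m ^ 2 / M))) *
            decayWeight a M ξ := by
  classical
  obtain ⟨C, hC, hker⟩ := exists_periodic_kernel
  refine ⟨C, hC, fun P Y M D t w hne hP hY hlog hM hD hMD hw => ?_⟩
  have hM0 : 0 < M := by linarith
  have hq0 : ∀ q ∈ P, (0 : ℝ) < q := fun q hq => hY.trans (hP q hq).2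
  have hwpos : ∀ q ∈ P, 0 < w q := fun q hq => (div_pos (hq0 q hq) hM0).trans_le (hw q hq)
  have hex : ∀ q : ℕ, ∃ (h : ℝ → ℝ) (c : ℤ → ℂ), q ∈ P → Continuous h ∧ (∀ y, 0 ≤ h y) ∧
      (∀ y, h y ≠ 0 → ∃ n : ℤ, |y - n| ≤ w q) ∧ c 0 = 1 ∧ Summable (fun m => ‖c m‖) ∧
      (∀ m : ℤ, ‖c m‖ ≤ C / (1 + w q * |(m : ℝ)|) ^ 5) ∧
      ∀ y : ℝ, HasSum (fun m : ℤ => c m * Complex.exp ((2 * Real.pi * m * y : ℝ) * Complex.I))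
        (h y : ℂ) := fun q => by
    by_cases hq : q ∈ P
    · obtain ⟨h, c, hh⟩ := hker (w q) (hwpos q hq)
      exact ⟨h, c, fun _ => hh⟩
    · exact ⟨0, 0, fun h => absurd h hq⟩
  choose h c hhc using hex
  have hcont : ∀ q ∈ P, Continuous fun x : ℝ => h q (q * x + t q) := fun q hq =>
    (hhc q hq).1.comp (by fun_prop)
  refine ⟨fun x => (P.card : ℝ)⁻¹ * ∑ q ∈ P, h q (q * x + t q),
    continuous_const.mul (continuous_finsetSum _ hcont),
    fun x => mul_nonneg (by positivity) (Finset.sum_nonneg fun q hq => (hhc q hq).2.1 _),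
    fun x hx => ?_, fun a m B ρ ha ha' hm hB hρc hρs hρB ξ => ?_⟩
  · obtain ⟨q, hq, hq'⟩ := Finset.exists_ne_zero_of_sum_ne_zero (right_ne_zero_of_mul hx)
    exact ⟨q, hq, (hhc q hq).2.2.1 _ hq'⟩
  · exact norm_densityFourier_mul_average_sub_le
      (hρc.integrable_of_hasCompactSupport hρs) hne (fun q hq => (hP q hq).1.ne_zero) hC
      (by linarith) ha ha' hm hM hB hρB
      (fun s hs => card_prime_divisors_le hP hY hlog hM0 hD hMD hs)
      (fun q hq => (hhc q hq).2.2.2.1) (fun q hq => (hhc q hq).2.2.2.2.1)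
      (fun q hq => (hhc q hq).2.2.2.2.2.1) hw (fun q hq => (hhc q hq).2.2.2.2.2.2)
      (fun q hq => (hρc.mul (hcont q hq)).integrable_of_hasCompactSupport hρs.mul_right) ξ

open scoped Pointwise in
theorem isClosed_near_int (P : Finset ℕ) (t w : ℕ → ℝ) :
    IsClosed {x : ℝ | ∃ q ∈ P, ∃ n : ℤ, |q * x + t q - n| ≤ w q} := by
  have e : {x : ℝ | ∃ q ∈ P, ∃ n : ℤ, |q * x + t q - n| ≤ w q} =
      ⋃ q ∈ P, (fun x : ℝ => q * x + t q) ⁻¹'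
        (Set.range ((↑) : ℤ → ℝ) + Set.Icc (-w q) (w q)) := by
    ext x
    simp only [Set.mem_ofPred_eq, Set.mem_iUnion, Set.mem_preimage, Set.mem_add, Set.mem_range,
      exists_exists_eq_and, Set.mem_Icc, exists_prop]
    refine exists_congr fun q => and_congr_right fun _ => exists_congr fun n => ?_
    rw [abs_le]
    exact ⟨fun h => ⟨_, h, by ring⟩, fun ⟨y, hy, hxy⟩ => by
      rw [← hxy, add_sub_cancel_left]; exact hy⟩
  rw [e]
  refine P.finite_toSet.isClosed_biUnion fun q _ => IsClosed.preimage (by fun_prop) ?_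
  exact Int.isClosedEmbedding_coe_real.isClosed_range.add_right_of_isCompact isCompact_Icc

/-- The left side is at most 2u^(-σ), so beating it with the separation of denominators u ≤ v only
requires v^g ≪ u^(σ-1). -/
theorem rpow_neg_add_rpow_neg_lt {c g σ u v : ℝ} (hu : 0 < u) (huv : u ≤ v) (hσ : 0 ≤ σ)
    (h : 2 * v ^ g < c * u ^ (σ - 1)) : u ^ (-σ) + v ^ (-σ) < c * v ^ (-g) / u := by
  have hv : 0 < v := hu.trans_le huv
  have h1 : v ^ (-σ) ≤ u ^ (-σ) := Real.rpow_le_rpow_of_nonpos hu huv (by linarith)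
  have h2 : u ^ (-σ) = (u ^ (σ - 1))⁻¹ / u := by
    rw [← Real.rpow_neg hu.le, neg_sub, sub_eq_add_neg, Real.rpow_add hu, Real.rpow_one]
    field_simp
  have hg : 0 < v ^ g := by positivity
  have hs : 0 < u ^ (σ - 1) := by positivity
  calc u ^ (-σ) + v ^ (-σ) ≤ 2 * u ^ (-σ) := by linarith
    _ = 2 / u ^ (σ - 1) / u := by rw [h2]; ring
    _ < c / v ^ g / u := by
        gcongr ?_ / u
        rw [div_lt_div_iff₀ hs hg]
        exact h
    _ = _ := by rw [Real.rpow_neg hv.le]; ring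

/-- Near a reduced shifted fraction with denominator about `N`, no other one with denominator
between `N^{1/b}` and `N^b` is close. -/
theorem eventually_window {θ γ g σ b ε : ℝ} {ψ : ℕ → ℝ}
    (hθ : (θ = 0 ∧ γ = 1) ∨ (Irrational θ ∧ HasDiophantineExponent θ γ)) (hg : γ < g)
    (hg0 : 0 < g) (hσ : 1 < σ) (hb : 0 < b) (hε : 0 < ε) (hε1 : ε < 1)
    (hbσ : b * g < (1 - ε) * (σ - 1)) (hψ : ∀ᶠ q : ℕ in atTop, ψ q ≤ (q : ℝ) ^ (-σ)) :
    ∀ᶠ N : ℝ in atTop, ∀ (r r' : ℤ) (q q' : ℕ), N ^ (1 - ε) < q → (q : ℝ) ≤ N →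
      IsCoprime r (q : ℤ) → IsCoprime r' (q' : ℤ) → N ^ b⁻¹ ≤ q' → (q' : ℝ) < N ^ b →
      (r', q') ≠ (r, q) →
      ψ q + ψ q' < |((r : ℝ) - θ) / q - ((r' : ℝ) - θ) / q'| := by
  obtain ⟨c, hc, hsep⟩ := exists_separation hθ hg
  obtain ⟨Q, hQ⟩ := eventually_atTop.1 hψ
  have hlarge : ∀ p : ℝ, 0 < p → ∀ A : ℝ, ∀ᶠ N : ℝ in atTop, A < N ^ p := fun p hp A =>
    (tendsto_rpow_atTop hp).eventually (eventually_gt_atTop A)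
  -- The two exponent gaps serve q ≤ q' < N^b with q > N^(1-ε), and N^(1/b) ≤ q' ≤ q ≤ N. Both hold
  -- for b below about (σ - 1)/g, which is where √β comes from.
  have hp1 : 0 < (1 - ε) * (σ - 1) - b * g := by linarith
  have hp2 : 0 < b⁻¹ * (σ - 1) - g := by
    have : b * g < σ - 1 := hbσ.trans_le (by nlinarith)
    have h2 : g < b⁻¹ * (σ - 1) := by
      rw [← div_eq_inv_mul, lt_div_iff₀ hb, mul_comm]; exact this
    linarith
  filter_upwards [hlarge _ (by linarith : 0 < 1 - ε) Q, hlarge _ (inv_pos.2 hb) Q,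
    hlarge _ hp1 (2 / c), hlarge _ hp2 (2 / c), eventually_ge_atTop 1] with
    N h1 h2 h3 h4 hN1 r r' q q' hqN hqN' hcop hcop' hq'N hq'N' hne
  have hN0 : 0 < N := by linarith
  have hq0 : (0 : ℝ) < q := lt_of_le_of_lt (by positivity) hqN
  have hq'0 : (0 : ℝ) < q' := lt_of_lt_of_le (by positivity) hq'N
  have hψq : ψ q ≤ (q : ℝ) ^ (-σ) := hQ q (by exact_mod_cast (h1.trans hqN).le)
  have hψq' : ψ q' ≤ (q' : ℝ) ^ (-σ) := hQ q' (by exact_mod_cast (h2.trans_le hq'N).le)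
  rcases le_total q q' with hle | hle
  · have h5 := hsep r r' q q' (by exact_mod_cast hq0) hle hcop hcop' hne.symm
    have h6 : 2 * (q' : ℝ) ^ g < c * (q : ℝ) ^ (σ - 1) := by
      calc 2 * (q' : ℝ) ^ g ≤ 2 * (N ^ b) ^ g := by gcongr
        _ = 2 * N ^ (b * g) := by rw [← Real.rpow_mul hN0.le]
        _ < c * N ^ ((1 - ε) * (σ - 1)) := by
            rw [div_lt_iff₀ hc, Real.rpow_sub hN0, div_mul_eq_mul_div,
              lt_div_iff₀ (by positivity)] at h3
            linarith
        _ = c * (N ^ (1 - ε)) ^ (σ - 1) := by rw [← Real.rpow_mul hN0.le]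
        _ ≤ c * (q : ℝ) ^ (σ - 1) := by gcongr
    have h7 := rpow_neg_add_rpow_neg_lt hq0 (by exact_mod_cast hle) (by linarith) h6
    linarith
  · have h5 := hsep r' r q' q (by exact_mod_cast hq'0) hle hcop' hcop hne
    rw [abs_sub_comm] at h5
    have h6 : 2 * (q : ℝ) ^ g < c * (q' : ℝ) ^ (σ - 1) := by
      calc 2 * (q : ℝ) ^ g ≤ 2 * N ^ g := by gcongr
        _ < c * N ^ (b⁻¹ * (σ - 1)) := by
            rw [div_lt_iff₀ hc, Real.rpow_sub hN0, div_mul_eq_mul_div,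
              lt_div_iff₀ (by positivity)] at h4
            linarith
        _ = c * (N ^ b⁻¹) ^ (σ - 1) := by rw [← Real.rpow_mul hN0.le]
        _ ≤ c * (q' : ℝ) ^ (σ - 1) := by gcongr
    have h7 := rpow_neg_add_rpow_neg_lt hq'0 (by exact_mod_cast hle) (by linarith) h6
    linarith

/-- Iterated powers of a large base dominate a geometric sequence. -/
theorem eventually_geometric_le_rpow {β η : ℝ} (hβ : 1 < β) (hη : 0 < η) (A : ℝ) :
    ∀ᶠ N : ℝ in atTop, ∀ k : ℕ, A * 2 ^ k ≤ (N ^ (β ^ k)) ^ η := by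
  have h1 : ∀ᶠ N : ℝ in atTop, max A 1 ≤ N ^ η :=
    (tendsto_rpow_atTop hη).eventually (eventually_ge_atTop _)
  have h2 : ∀ᶠ N : ℝ in atTop, 2 ≤ N ^ ((β - 1) * η) :=
    (tendsto_rpow_atTop (mul_pos (by linarith) hη)).eventually (eventually_ge_atTop _)
  filter_upwards [h1, h2, eventually_ge_atTop 1] with N h1 h2 hN k
  have hN0 : 0 < N := by linarith
  -- Bernoulli turns the doubly exponential growth into a geometric lower bound of ratio N^((β-1)η)
  -- ≥ 2.
  have hbern : 1 + k * (β - 1) ≤ β ^ k := by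
    have := one_add_mul_le_pow (a := β - 1) (by linarith) k
    simpa using this
  calc A * 2 ^ k ≤ N ^ η * (N ^ ((β - 1) * η)) ^ k := by
        gcongr
        exact (le_max_left _ _).trans h1
    _ = N ^ ((1 + k * (β - 1)) * η) := by
        rw [← Real.rpow_natCast, ← Real.rpow_mul hN0.le, ← Real.rpow_add hN0]
        ring_nf
    _ ≤ N ^ (β ^ k * η) := Real.rpow_le_rpow_of_exponent_le hN (by gcongr)
    _ = _ := Real.rpow_mul hN0.le _ _

/-- Unpacks the condition that `q x + θ` is at distance at most `w` from the point
`n + q ψ₁ - w`, where `w = q ψ₂ / (2 (k + 1))`. -/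
theorem approx_of_near_int {θ x ψ₁ ψ₂ : ℝ} {q k : ℕ} {n : ℤ} (hθ : θ ∈ Set.Ico (0 : ℝ) 1)
    (hx : x ∈ Set.Icc (1 / 4 : ℝ) (3 / 4)) (hp : q.Prime) (hq : (4 : ℝ) < q) (hψ₂ : 0 ≤ ψ₂)
    (hψ : ψ₂ ≤ ψ₁) (hψ₁ : ψ₁ < 1 / 4)
    (h : |q * x + (θ - q * ψ₁ + q * ψ₂ / (2 * (k + 1))) - n| ≤ q * ψ₂ / (2 * (k + 1))) :
    IsCoprime n (q : ℤ) ∧ ψ₁ - ψ₂ / (k + 1) ≤ x - ((n : ℝ) - θ) / q ∧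
      0 ≤ x - ((n : ℝ) - θ) / q ∧ x - ((n : ℝ) - θ) / q ≤ ψ₁ := by
  have hq0 : (0 : ℝ) < q := by linarith
  have hk : (1 : ℝ) ≤ k + 1 := le_add_of_nonneg_left (Nat.cast_nonneg k)
  obtain ⟨h1, h2⟩ := abs_le.1 h
  have ew : q * ψ₂ / (2 * ((k : ℝ) + 1)) = q * (ψ₂ / (k + 1)) / 2 := by field_simp
  rw [ew] at h1 h2
  have e : x - ((n : ℝ) - θ) / q = (q * x + θ - n) / q := by field_simp; ring
  have hle : ψ₂ / (k + 1) ≤ ψ₂ := div_le_self hψ₂ hk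
  have hl : ψ₁ - ψ₂ / (k + 1) ≤ x - ((n : ℝ) - θ) / q := by
    rw [e, le_div_iff₀ hq0]; linarith
  have hu : x - ((n : ℝ) - θ) / q ≤ ψ₁ := by
    rw [e, div_le_iff₀ hq0]; linarith
  have hl0 : 0 ≤ x - ((n : ℝ) - θ) / q := by linarith
  refine ⟨?_, hl, hl0, hu⟩
  have hn1 : (n : ℝ) ≤ q * x + θ := by
    rw [e, le_div_iff₀ hq0] at hl0; linarith
  have hn2 : q * x + θ - q * ψ₁ ≤ n := by
    rw [e, div_le_iff₀ hq0] at hu; linarith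
  -- Staying in [1/4, 3/4], with ψ₁ < 1/4 and q > 4, forces 0 < n < q; primality of q then gives
  -- coprimality.
  have hnpos : (0 : ℝ) < n := by nlinarith [hθ.1, hx.1]
  have hnlt : (n : ℝ) < q := by nlinarith [hθ.2, hx.2]
  have hz1 : 0 < n := by exact_mod_cast hnpos
  have hz2 : n < q := by exact_mod_cast hnlt
  have hnd : ¬ (q : ℤ) ∣ n := fun hd => absurd (Int.le_of_dvd hz1 hd) (not_le.2 hz2)
  exact ((Nat.prime_iff_prime_int.1 hp).coprime_iff_not_dvd.2 hnd).symm

theorem div_pow_le_decayWeight {a m B t : ℝ} (ha : a ≤ 1) (hm : 1 ≤ m) (hB : 0 ≤ B) :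
    B / (1 + |t|) ^ 3 ≤ B * decayWeight a m t := by
  rw [div_eq_mul_inv]
  refine mul_le_mul_of_nonneg_left ?_ hB
  have h1 : (1 : ℝ) ≤ 1 + |t| := le_add_of_nonneg_right (abs_nonneg t)
  have h2 : |t| / m ≤ |t| := div_le_self (abs_nonneg t) hm
  have hm0 : 0 < m := by linarith
  have h3 : (1 + |t|)⁻¹ ≤ (1 + |t|) ^ (-a) := by
    rw [← Real.rpow_neg_one]; exact Real.rpow_le_rpow_of_exponent_le h1 (by linarith)
  calc ((1 + |t|) ^ 3)⁻¹ = (1 + |t|)⁻¹ * ((1 + |t|) ^ 2)⁻¹ := by rw [← mul_inv]; ring_nf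
    _ ≤ _ := by unfold decayWeight; gcongr

theorem SupportsFourierDecay.mono {E E' : Set ℝ} {s : ℝ} (h : SupportsFourierDecay E s)
    (hE : E ⊆ E') : SupportsFourierDecay E' s := by
  obtain ⟨μ, K, C, h1, h2, h3, h4⟩ := h
  exact ⟨μ, K, C, h1, h2, h3.trans hE, h4⟩

/-- N^t is the new scale, N^(t/b²) the previous one, and N^(1-ε) bounds the number of primes from
below; η is the net saving. -/
theorem step_factor_le {N t a b ε η : ℝ} (hN : 1 ≤ N)
    (h1 : t * a + t / b ^ 2 * (1 - a) + η ≤ 1 - ε) (h2 : 2 * (t / b ^ 2) - t + η ≤ 1 - ε) :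
    (N ^ (1 - ε))⁻¹ * ((N ^ t) ^ a * (N ^ (t / b ^ 2)) ^ (1 - a) +
      (N ^ (t / b ^ 2)) ^ 2 / N ^ t) ≤ 2 * (N ^ η)⁻¹ := by
  have hN0 : 0 < N := by linarith
  have e1 : (N ^ t) ^ a * (N ^ (t / b ^ 2)) ^ (1 - a) = N ^ (t * a + t / b ^ 2 * (1 - a)) := by
    rw [← Real.rpow_mul hN0.le, ← Real.rpow_mul hN0.le, ← Real.rpow_add hN0]
  have e2 : (N ^ (t / b ^ 2)) ^ 2 / N ^ t = N ^ (2 * (t / b ^ 2) - t) := by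
    rw [← Real.rpow_natCast, ← Real.rpow_mul hN0.le, ← Real.rpow_sub hN0]
    congr 1
    push_cast
    ring
  have h3 : N ^ (t * a + t / b ^ 2 * (1 - a)) ≤ N ^ ((1 - ε) - η) :=
    Real.rpow_le_rpow_of_exponent_le hN (by linarith)
  have h4 : N ^ (2 * (t / b ^ 2) - t) ≤ N ^ ((1 - ε) - η) :=
    Real.rpow_le_rpow_of_exponent_le hN (by linarith)
  have e3 : N ^ ((1 - ε) - η) = N ^ (1 - ε) * (N ^ η)⁻¹ := by
    rw [Real.rpow_sub hN0, div_eq_mul_inv]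
  have hpos : 0 < N ^ (1 - ε) := by positivity
  rw [e1, e2, inv_mul_le_iff₀ hpos]
  calc _ ≤ 2 * N ^ ((1 - ε) - η) := by linarith
    _ = _ := by rw [e3]; ring

/-! ### Assembly of the construction and choice of parameters. -/

theorem supportsFourierDecay_tight {θ γ g σ b ε t a : ℝ} {ψ₁ ψ₂ : ℕ → ℝ}
    (hθ_mem : θ ∈ Set.Ico (0 : ℝ) 1)
    (hθ : (θ = 0 ∧ γ = 1) ∨ (Irrational θ ∧ HasDiophantineExponent θ γ))
    (hψ₂_pos : ∀ q : ℕ, 1 ≤ q → 0 < ψ₂ q) (hψ_le : ∀ q : ℕ, 1 ≤ q → ψ₂ q ≤ ψ₁ q)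
    (hg : γ < g) (hg0 : 0 < g) (hσ : 1 < σ) (hb : 1 < b) (hε : 0 < ε) (hε1 : ε < 1)
    (hbσ : b * g < (1 - ε) * (σ - 1)) (hψ₁ : ∀ᶠ q : ℕ in atTop, ψ₁ q ≤ (q : ℝ) ^ (-σ))
    (hψ₂ : ∀ᶠ q : ℕ in atTop, (q : ℝ) ^ (-(t - ε)) ≤ ψ₂ q)
    (ht : ε ≤ t) (ha : 0 ≤ a) (ha' : a ≤ 1 / 2)
    (h1 : t * a + t / b ^ 2 * (1 - a) < 1 - ε) (h2 : 2 * (t / b ^ 2) - t < 1 - ε) :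
    SupportsFourierDecay (Tight ψ₁ ψ₂ θ) (2 * a) := by
  obtain ⟨C, hC, hmul⟩ := exists_multiplier
  obtain ⟨ρ₀, hρc, hρ0, hρs, hρi, B, hB, hρd⟩ :=
    exists_smooth_density (1 / 2) (1 / 4) (by norm_num) 3
  -- t/(1-ε) is the ratio log M / log Y for M = N^t and Y = N^(1-ε).
  set D : ℝ := max 1 (t / (1 - ε)) with hD
  set δ : ℝ := min (1 / 4) (1 / (8 * B)) with hδ
  have hδ0 : 0 < δ := lt_min (by norm_num) (by positivity)
  set η : ℝ := min ((1 - ε) - (t * a + t / b ^ 2 * (1 - a))) ((1 - ε) - (2 * (t / b ^ 2) - t))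
    with hη
  have hη0 : 0 < η := lt_min (by linarith) (by linarith)
  have hη1 : t * a + t / b ^ 2 * (1 - a) + η ≤ 1 - ε := by
    linarith [min_le_left ((1 - ε) - (t * a + t / b ^ 2 * (1 - a)))
      ((1 - ε) - (2 * (t / b ^ 2) - t))]
  have hη2 : 2 * (t / b ^ 2) - t + η ≤ 1 - ε := by
    linarith [min_le_right ((1 - ε) - (t * a + t / b ^ 2 * (1 - a)))
      ((1 - ε) - (2 * (t / b ^ 2) - t))]
  have hb2 : 1 < b ^ 2 := one_lt_pow₀ hb two_ne_zero
  have hb0 : 0 < b := by linarith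
  have ht0 : 0 < t := hε.trans_le ht
  obtain ⟨Q, hQ⟩ := eventually_atTop.1 (hψ₁.and hψ₂)
  have hYlarge : ∀ A : ℝ, ∀ᶠ N : ℝ in atTop, A < N ^ (1 - ε) := fun A =>
    (tendsto_rpow_atTop (by linarith : 0 < 1 - ε)).eventually (eventually_gt_atTop A)
  obtain ⟨X, hX⟩ := eventually_atTop.1 ((eventually_card_primesIoc_ge hε hε1).and
    ((eventually_window hθ hg hg0 hσ hb0 hε hε1 hbσ hψ₁).and ((hYlarge (max Q 4)).and
      (hYlarge (Real.exp 1)))))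
  obtain ⟨N₀, hN₀X, hN₀2, hgrow1, hgrow2⟩ := ((eventually_ge_atTop X).and
    ((eventually_ge_atTop (2 : ℝ)).and
      ((eventually_geometric_le_rpow hb2 hη0 (C * D * (2560 * 2) / δ)).and
        (eventually_geometric_le_rpow hb2 hε 2)))).exists
  -- The ratio b² of successive exponents makes the windows [N^(1/b), N^b) abut.
  set N : ℕ → ℝ := fun k => N₀ ^ ((b ^ 2) ^ k) with hN
  have hN₀0 : 0 < N₀ := by linarith
  have hNpos : ∀ k, 0 < N k := fun k => by positivity
  have hNge : ∀ k, N₀ ≤ N k := fun k => by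
    calc N₀ = N₀ ^ (1 : ℝ) := (Real.rpow_one _).symm
      _ ≤ _ := Real.rpow_le_rpow_of_exponent_le (by linarith) (one_le_pow₀ hb2.le)
  have hN1 : ∀ k, 1 ≤ N k := fun k => by linarith [hNge k]
  have hNsucc : ∀ k, N (k + 1) = N k ^ (b ^ 2) := fun k => by
    simp only [hN]
    rw [← Real.rpow_mul hN₀0.le, pow_succ]
  have hNX : ∀ k, X ≤ N k := fun k => hN₀X.trans (hNge k)
  have hNtop : Tendsto N atTop atTop :=
    (tendsto_rpow_atTop_of_base_gt_one N₀ (by linarith)).comp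
      (tendsto_pow_atTop_atTop_of_one_lt hb2)
  have hYpos : ∀ k, 0 < N k ^ (1 - ε) := fun k => Real.rpow_pos_of_pos (hNpos k) _
  have hlogY : ∀ k, 1 ≤ Real.log (N k ^ (1 - ε)) := fun k => by
    rw [Real.le_log_iff_exp_le (hYpos k)]
    exact (hX (N k) (hNX k)).2.2.2.le
  -- properties of the admissible denominators at level `k`
  have hden : ∀ (k q : ℕ), N k ^ (1 - ε) < q → (4 : ℝ) < q ∧ 1 ≤ q ∧ ψ₁ q < 1 / 4 ∧
      ψ₁ q ≤ (q : ℝ) ^ (-σ) ∧ (q : ℝ) ^ (-(t - ε)) ≤ ψ₂ q := fun k q hq => by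
    have h3 := (hX (N k) (hNX k)).2.2.1.trans hq
    have h4 : (4 : ℝ) < q := (le_max_right _ _).trans_lt h3
    have h5 : Q ≤ q := by exact_mod_cast ((le_max_left _ _).trans_lt h3).le
    have h6 := hQ q h5
    have h7 : (q : ℝ) ^ (-σ) < 1 / 4 := by
      calc (q : ℝ) ^ (-σ) ≤ (q : ℝ) ^ (-1 : ℝ) :=
            Real.rpow_le_rpow_of_exponent_le (by linarith) (by linarith)
        _ = 1 / q := by rw [Real.rpow_neg_one, one_div]
        _ < 1 / 4 := one_div_lt_one_div_of_lt (by norm_num) h4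
    exact ⟨h4, by exact_mod_cast (by linarith : (1 : ℝ) ≤ q), by linarith [h6.1], h6.1, h6.2⟩
  -- Multiplier k uses level k + 1: it takes a density at scale `m k` to scale `m (k + 1)`, and
  -- scale `m 0` belongs to the initial density.
  set P : ℕ → Finset ℕ := fun k => primesIoc (N (k + 1) ^ (1 - ε)) (N (k + 1)) with hP
  have hPmem : ∀ k q, q ∈ P k →
      q.Prime ∧ N (k + 1) ^ (1 - ε) < q ∧ (q : ℝ) ≤ N (k + 1) := fun k q hq =>
    (mem_primesIoc (hNpos _).le).1 hq
  have hPcard : ∀ k, N (k + 1) ^ (1 - ε) ≤ (P k).card := fun k => (hX _ (hNX (k + 1))).1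
  have hPne : ∀ k, (P k).Nonempty := fun k => by
    rw [← Finset.card_pos]
    exact_mod_cast (hYpos (k + 1)).trans_le (hPcard k)
  set w : ℕ → ℕ → ℝ := fun k q => q * ψ₂ q / (2 * (k + 1)) with hw
  set sh : ℕ → ℕ → ℝ := fun k q => θ - q * ψ₁ q + q * ψ₂ q / (2 * (k + 1)) with hsh
  set m : ℕ → ℝ := fun k => N k ^ t with hm
  have hm1 : ∀ k, 1 ≤ m k := fun k => Real.one_le_rpow (hN1 k) ht0.le
  have hmN : ∀ k, m k = N (k + 1) ^ (t / b ^ 2) := fun k => by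
    rw [hm, hNsucc, ← Real.rpow_mul (hNpos k).le]
    field_simp
  have hD1 : 1 ≤ D := le_max_left _ _
  have hMD : ∀ k, Real.log (m k) ≤ D * Real.log (N k ^ (1 - ε)) := fun k => by
    have hlog : 0 ≤ Real.log (N k) := Real.log_nonneg (hN1 k)
    have h3 : t ≤ D * (1 - ε) := by
      rw [← div_le_iff₀ (by linarith)]; exact le_max_right _ _
    rw [hm, Real.log_rpow (hNpos k), Real.log_rpow (hNpos k), ← mul_assoc]
    gcongr
  -- The bumps are no narrower than the scale allows: ψ₂(q) ≥ N^(-(t-ε)), and the spare N^ε absorbs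
  -- 2(k + 1).
  have hwle : ∀ k, ∀ q ∈ P k, (q : ℝ) / m (k + 1) ≤ w k q := fun k q hq => by
    obtain ⟨-, hq1, hq2⟩ := hPmem k q hq
    obtain ⟨h4, -, -, -, hlow⟩ := hden (k + 1) q hq1
    have hq0 : (0 : ℝ) < q := by linarith
    have hk2 : (k : ℝ) + 1 ≤ 2 ^ (k + 1) := by
      exact_mod_cast (Nat.lt_two_pow_self (n := k + 1)).le
    have h5 : 2 * ((k : ℝ) + 1) ≤ N (k + 1) ^ ε := by
      have := hgrow2 (k + 1)
      exact le_trans (by linarith) this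
    have h6 : N (k + 1) ^ (-(t - ε)) ≤ ψ₂ q :=
      (Real.rpow_le_rpow_of_nonpos hq0 hq2 (by linarith)).trans hlow
    have h7 : (m (k + 1))⁻¹ * (2 * (k + 1)) ≤ ψ₂ q := by
      calc (m (k + 1))⁻¹ * (2 * (k + 1)) ≤ (m (k + 1))⁻¹ * N (k + 1) ^ ε := by
            have := (hm1 (k + 1)); gcongr
        _ = N (k + 1) ^ (-(t - ε)) := by
            rw [hm, ← Real.rpow_neg (hNpos _).le, ← Real.rpow_add (hNpos _)]
            ring_nf
        _ ≤ _ := h6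
    rw [hw, le_div_iff₀ (by positivity)]
    calc (q : ℝ) / m (k + 1) * (2 * (k + 1)) = q * ((m (k + 1))⁻¹ * (2 * (k + 1))) := by ring
      _ ≤ q * ψ₂ q := by gcongr
  choose F hFc hF0 hFs hFstep using fun k => hmul (P k) (N (k + 1) ^ (1 - ε)) (m (k + 1)) D
    (sh k) (w k) (hPne k) (fun q hq => ⟨(hPmem k q hq).1, (hPmem k q hq).2.1⟩) (hYpos _) (hlogY _)
    (hm1 _) hD1 (hMD _) (hwle k)
  have hdecay := supportsFourierDecay_of_multipliers (ρ₀ := ρ₀) (K₀ := Set.Icc (1 / 4) (3 / 4))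
    (F := F) (E := fun k => {x : ℝ | ∃ q ∈ P k, ∃ n : ℤ, |q * x + sh k q - n| ≤ w k q})
    (m := m) (a := a) (B := B) (δ := δ) ha (fun k => by linarith [hm1 k])
    (fun k => ?_) hB (min_le_left _ _) ?_ hρc.continuous hρ0 hρi isCompact_Icc
    (fun x hx => ?_) (fun ξ => (hρd ξ).trans (div_pow_le_decayWeight (by linarith) (hm1 0) hB.le))
    hFc hF0 (fun k => isClosed_near_int _ _ _) hFs (fun k ρ B' hρ hρ' hB' hρB ξ => ?_)
  · refine hdecay.mono fun x hx => ?_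
    have hxE := fun k => Set.mem_iInter.1 hx.2 k
    choose q hqP n hqn using hxE
    have happ := fun k => approx_of_near_int hθ_mem hx.1 (hPmem k (q k) (hqP k)).1
      (hden (k + 1) (q k) (hPmem k (q k) (hqP k)).2.1).1
      (hψ₂_pos _ (hden (k + 1) (q k) (hPmem k (q k) (hqP k)).2.1).2.1).le
      (hψ_le _ (hden (k + 1) (q k) (hPmem k (q k) (hqP k)).2.1).2.1)
      (hden (k + 1) (q k) (hPmem k (q k) (hqP k)).2.1).2.2.1 (hqn k)
    have hNs : Tendsto (fun k => N (k + 1)) atTop atTop := (tendsto_add_atTop_iff_nat 1).2 hNtop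
    refine mem_tight_of_windows hψ₂_pos (L := fun k => N (k + 1) ^ b⁻¹) (r := n) (q := q)
      ((tendsto_rpow_atTop (inv_pos.2 hb0)).comp hNs)
      (fun k => (hden (k + 1) (q k) (hPmem k (q k) (hqP k)).2.1).2.1) ?_
      (fun k => (happ k).1) (fun k => (happ k).2.1) (fun k => (happ k).2.2.1)
      (fun k => (happ k).2.2.2) fun k r' q' hq' hcop hL hL' hne => ?_
    · rw [← tendsto_natCast_atTop_iff (R := ℝ)]
      exact tendsto_atTop_mono (fun k => (hPmem k (q k) (hqP k)).2.1.le)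
        ((tendsto_rpow_atTop (by linarith : 0 < 1 - ε)).comp hNs)
    · refine (hX (N (k + 1)) (hNX _)).2.1 (n k) r' (q k) q' (hPmem k (q k) (hqP k)).2.1
        (hPmem k (q k) (hqP k)).2.2 (happ k).1 hcop hL ?_ hne
      have e : N (k + 1 + 1) ^ b⁻¹ = N (k + 1) ^ b := by
        rw [hNsucc (k + 1), ← Real.rpow_mul (hNpos _).le]
        congr 1
        field_simp
      rwa [e] at hL'
  · have : N k ≤ N (k + 1) := by
      calc N k = N k ^ (1 : ℝ) := (Real.rpow_one _).symm
        _ ≤ N k ^ (b ^ 2) := Real.rpow_le_rpow_of_exponent_le (hN1 k) hb2.le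
        _ = _ := (hNsucc k).symm
    exact Real.rpow_le_rpow (hNpos k).le this ht0.le
  · have : δ ≤ 1 / (8 * B) := min_le_right _ _
    calc 8 * B * δ ≤ 8 * B * (1 / (8 * B)) := by gcongr
      _ = 1 := by field_simp
  · have h3 := abs_le.1 (hρs x hx)
    exact ⟨by linarith [h3.1], by linarith [h3.2]⟩
  · refine (hFstep k a (m k) B' ρ ha ha' (hm1 k) hB' hρ hρ' hρB ξ).trans ?_
    have hW := decayWeight_pos a ξ (by linarith [hm1 (k + 1)] : 0 < m (k + 1))
    refine mul_le_mul_of_nonneg_right ?_ hW.le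
    have h3 := step_factor_le (hN1 (k + 1)) hη1 hη2
    rw [← hmN] at h3
    have hNη : 0 < N (k + 1) ^ η := Real.rpow_pos_of_pos (hNpos _) _
    have h4 : C * D * (2560 * 2) / δ * 2 ^ (k + 1) ≤ N (k + 1) ^ η := hgrow1 (k + 1)
    have h5 : C * D * (2560 * 2) * (N (k + 1) ^ η)⁻¹ ≤ δ * (1 / 2) ^ k := by
      rw [← div_eq_mul_inv, div_le_iff₀ hNη]
      have h6 : C * D * (2560 * 2) / δ * 2 ^ k ≤ N (k + 1) ^ η := by
        refine le_trans ?_ h4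
        have : (2 : ℝ) ^ k ≤ 2 ^ (k + 1) := pow_le_pow_right₀ (by norm_num) (Nat.le_succ k)
        have hD0 : 0 < D := by linarith
        gcongr
      calc C * D * (2560 * 2) = δ * (1 / 2) ^ k * (C * D * (2560 * 2) / δ * 2 ^ k) := by
            rw [one_div, inv_pow]; field_simp
        _ ≤ _ := by gcongr
    have hcard : ((P k).card : ℝ)⁻¹ ≤ (N (k + 1) ^ (1 - ε))⁻¹ := inv_anti₀ (hYpos _) (hPcard k)
    set Z : ℝ := m (k + 1) ^ a * m k ^ (1 - a) + m k ^ 2 / m (k + 1) with hZ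
    have hZ0 : 0 ≤ Z := by
      have := hm1 k
      have := hm1 (k + 1)
      positivity
    have hD0 : 0 < D := by linarith
    calc ((P k).card : ℝ)⁻¹ * (C * D * B' * (2560 * Z))
        ≤ (N (k + 1) ^ (1 - ε))⁻¹ * (C * D * B' * (2560 * Z)) := by gcongr
      _ = C * D * B' * 2560 * ((N (k + 1) ^ (1 - ε))⁻¹ * Z) := by ring
      _ ≤ C * D * B' * 2560 * (2 * (N (k + 1) ^ η)⁻¹) := by gcongr
      _ = B' * (C * D * (2560 * 2) * (N (k + 1) ^ η)⁻¹) := by ring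
      _ ≤ _ := by gcongr

theorem HasOrder.le_of_le {ψ₁ ψ₂ : ℕ → ℝ} {τ₁ τ₂ : ℝ} (h₁ : HasOrder ψ₁ τ₁) (h₂ : HasOrder ψ₂ τ₂)
    (hpos : ∀ q : ℕ, 1 ≤ q → 0 < ψ₂ q) (hle : ∀ q : ℕ, 1 ≤ q → ψ₂ q ≤ ψ₁ q) : τ₁ ≤ τ₂ := by
  refine le_of_tendsto_of_tendsto h₁ h₂ ?_
  filter_upwards [eventually_ge_atTop 2] with q hq
  have hlog : 0 < Real.log q := Real.log_pos (by exact_mod_cast hq)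
  have := Real.log_le_log (hpos q (by omega)) (hle q (by omega))
  gcongr

theorem le_fourierDim {E : Set ℝ} {s : ℝ} (h0 : 0 ≤ s) (h1 : s ≤ 1)
    (h : SupportsFourierDecay E s) : s ≤ fourierDim E :=
  le_csSup ⟨1, fun _ hx => hx.2.1⟩ ⟨h0, h1, h⟩

/-- At b² = β and t = τ₂ the main exponent condition is a rearrangement of the bound on a. All
conditions are strict and continuous in the parameters, so they survive taking b slightly below √β
and then ε small. -/
theorem supportsFourierDecay_tight_of_lt {θ γ τ₁ τ₂ β a : ℝ} {ψ₁ ψ₂ : ℕ → ℝ}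
    (hθ_mem : θ ∈ Set.Ico (0 : ℝ) 1)
    (hθ : (θ = 0 ∧ γ = 1) ∨ (Irrational θ ∧ HasDiophantineExponent θ γ)) (hγ : 1 ≤ γ)
    (hψ₂_pos : ∀ q : ℕ, 1 ≤ q → 0 < ψ₂ q) (hψ_le : ∀ q : ℕ, 1 ≤ q → ψ₂ q ≤ ψ₁ q)
    (hτ₁ : HasOrder ψ₁ τ₁) (hτ₂ : HasOrder ψ₂ τ₂) (hτ₁_gt : 1 < τ₁) (hτ₂_gt : 1 < τ₂)
    (hβ : β = γ⁻¹ ^ 2 * (τ₁ - 1) ^ 2) (hβτ₂ : τ₂ < β) (ha : 0 ≤ a) (ha' : a ≤ 1 / 2)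
    (haβ : a < (β - τ₂) / (τ₂ * (β - 1))) :
    SupportsFourierDecay (Tight ψ₁ ψ₂ θ) (2 * a) := by
  have hγ0 : 0 < γ := by linarith
  set b₀ : ℝ := (τ₁ - 1) / γ with hb₀
  have hb₀0 : 0 < b₀ := div_pos (by linarith) hγ0
  have hβb : β = b₀ ^ 2 := by rw [hβ, hb₀]; field_simp
  have hβ1 : 1 < β := hτ₂_gt.trans hβτ₂
  have hβ0 : 0 < β := by linarith
  have hb₀1 : 1 < b₀ := by
    by_contra! h
    nlinarith
  have hA : τ₂ * a + τ₂ / b₀ ^ 2 * (1 - a) < 1 := by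
    rw [← hβb]
    rw [lt_div_iff₀ (by nlinarith)] at haβ
    have e : τ₂ * a + τ₂ / β * (1 - a) = (τ₂ * a * β + τ₂ * (1 - a)) / β := by field_simp
    rw [e, div_lt_one hβ0]
    nlinarith
  have hA2 : 2 * (τ₂ / b₀ ^ 2) - τ₂ < 1 := by
    rw [← hβb]
    have : τ₂ / β < 1 := (div_lt_one hβ0).2 hβτ₂
    linarith
  -- shrink `b` below `b₀`, keeping the two exponent inequalities
  have hb_ev : ∀ᶠ b in 𝓝[<] b₀, (τ₂ * a + τ₂ / b ^ 2 * (1 - a) < 1 ∧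
      2 * (τ₂ / b ^ 2) - τ₂ < 1 ∧ 1 < b) ∧ b < b₀ := by
    have hb₀2 : b₀ ^ 2 ≠ 0 := by positivity
    have c1 : ContinuousAt (fun b : ℝ => τ₂ * a + τ₂ / b ^ 2 * (1 - a)) b₀ := by
      fun_prop (disch := assumption)
    have c2 : ContinuousAt (fun b : ℝ => 2 * (τ₂ / b ^ 2) - τ₂) b₀ := by
      fun_prop (disch := assumption)
    refine Eventually.and (Filter.Eventually.filter_mono nhdsWithin_le_nhds ?_) self_mem_nhdsWithin
    exact (c1.eventually_lt_const hA).and ((c2.eventually_lt_const hA2).and (lt_mem_nhds hb₀1))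
  obtain ⟨b, ⟨hb1, hb2, hb3⟩, hb4⟩ := hb_ev.exists
  have hbγ : b * γ < τ₁ - 1 := by rwa [hb₀, lt_div_iff₀ hγ0] at hb4
  -- then choose the loss `ε`
  have hε_ev : ∀ᶠ ε in 𝓝[>] (0 : ℝ), (b * (γ + ε) < (1 - ε) * (τ₁ - ε - 1) ∧
      (τ₂ + 2 * ε) * a + (τ₂ + 2 * ε) / b ^ 2 * (1 - a) < 1 - ε ∧
      2 * ((τ₂ + 2 * ε) / b ^ 2) - (τ₂ + 2 * ε) < 1 - ε ∧ ε < 1 ∧ 1 < τ₁ - ε) ∧ 0 < ε := by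
    refine Eventually.and (Filter.Eventually.filter_mono nhdsWithin_le_nhds ?_) self_mem_nhdsWithin
    have hc : ∀ f g : ℝ → ℝ, Continuous f → Continuous g → f 0 < g 0 →
        ∀ᶠ ε in 𝓝 (0 : ℝ), f ε < g ε := fun f g hf hg h =>
      hf.continuousAt.eventually_lt hg.continuousAt h
    refine (hc _ _ (by fun_prop) (by fun_prop) (by simpa using hbγ)).and
      ((hc _ _ (by fun_prop) (by fun_prop) (by simpa using hb1)).and
      ((hc _ _ (by fun_prop) (by fun_prop) (by simpa using hb2)).and
      ((hc _ _ (by fun_prop) (by fun_prop) (by simp)).and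
      (hc _ _ (by fun_prop) (by fun_prop) (by simpa using hτ₁_gt)))))
  obtain ⟨ε, ⟨he1, he2, he3, he4, he5⟩, hε⟩ := hε_ev.exists
  have hψ₁_pos : ∀ q : ℕ, 1 ≤ q → 0 < ψ₁ q := fun q hq => (hψ₂_pos q hq).trans_le (hψ_le q hq)
  refine supportsFourierDecay_tight (g := γ + ε) (σ := τ₁ - ε) (b := b) (ε := ε)
    (t := τ₂ + 2 * ε) hθ_mem hθ hψ₂_pos hψ_le (by linarith) (by linarith) he5 hb3 hε he4 he1
    ?_ ?_ (by linarith) ha ha' he2 he3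
  · filter_upwards [eventually_rpow_bounds_of_hasOrder hψ₁_pos hτ₁ hε] with q hq using hq.2
  · filter_upwards [eventually_rpow_bounds_of_hasOrder hψ₂_pos hτ₂ hε] with q hq
    rw [show τ₂ + 2 * ε - ε = τ₂ + ε by ring]
    exact hq.1

theorem theorem2 (θ γ τ₁ τ₂ β : ℝ) (ψ₁ ψ₂ : ℕ → ℝ)
    (hθ_mem : θ ∈ Set.Ico (0 : ℝ) 1)
    (hθ : (θ = 0 ∧ γ = 1) ∨ (Irrational θ ∧ HasDiophantineExponent θ γ))
    (hψ₂_pos : ∀ q : ℕ, 1 ≤ q → 0 < ψ₂ q)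
    (hψ_le : ∀ q : ℕ, 1 ≤ q → ψ₂ q ≤ ψ₁ q)
    (hψ₁_anti : AntitoneOn ψ₁ (Set.Ici 1))
    (hψ₂_anti : AntitoneOn ψ₂ (Set.Ici 1))
    (hdiff_anti : AntitoneOn (fun q => ψ₁ q - ψ₂ q) (Set.Ici 1))
    (hτ₁ : HasOrder ψ₁ τ₁) (hτ₂ : HasOrder ψ₂ τ₂)
    (hτ₁_gt : 1 < τ₁)
    (hβ : β = γ⁻¹ ^ 2 * (τ₁ - 1) ^ 2)
    (hβτ₂ : τ₂ < β) :
    0 < fourierDim (Tight ψ₁ ψ₂ θ) ∧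
      2 * (β - τ₂) / (τ₂ * (β - 1)) ≤ fourierDim (Tight ψ₁ ψ₂ θ) := by
  have hτ : τ₁ ≤ τ₂ := hτ₁.le_of_le hτ₂ hψ₂_pos hψ_le
  have hγ : 1 ≤ γ := by
    rcases hθ with ⟨-, h⟩ | ⟨-, h⟩
    · exact h.ge
    · exact one_le_of_hasDiophantineExponent h
  have hτ₂_gt : 1 < τ₂ := hτ₁_gt.trans_le hτ
  have hβle : β ≤ (τ₁ - 1) ^ 2 := by
    have h1 : γ⁻¹ ^ 2 ≤ 1 := pow_le_one₀ (by positivity) (inv_le_one_of_one_le₀ hγ)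
    rw [hβ]
    exact mul_le_of_le_one_left (sq_nonneg _) h1
  -- From τ₂ < β ≤ (τ₁ - 1)² ≤ (τ₂ - 1)². This makes the claimed bound at most 1, hence a ≤ 1/2 as
  -- the lattice sums require.
  have hτ₂2 : 2 ≤ τ₂ := by nlinarith
  have hden : 0 < τ₂ * (β - 1) := mul_pos (by linarith) (by linarith)
  set S : ℝ := 2 * (β - τ₂) / (τ₂ * (β - 1)) with hS
  have hS0 : 0 < S := div_pos (by linarith) hden
  have hS1 : S ≤ 1 := by rw [hS, div_le_one hden]; nlinarith
  have hle : S ≤ fourierDim (Tight ψ₁ ψ₂ θ) := by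
    refine le_of_forall_lt_imp_le_of_dense fun s hs => ?_
    have h1 : max s 0 < S := max_lt hs hS0
    have h2 : max s 0 / 2 < (β - τ₂) / (τ₂ * (β - 1)) := by
      rw [div_lt_iff₀ two_pos, div_mul_eq_mul_div, mul_comm _ (2 : ℝ)]; exact h1
    have h3 := supportsFourierDecay_tight_of_lt hθ_mem hθ hγ hψ₂_pos hψ_le hτ₁ hτ₂ hτ₁_gt hτ₂_gt hβ
      hβτ₂ (div_nonneg (le_max_right s 0) two_pos.le) (by linarith) h2
    rw [mul_div_cancel₀ _ two_ne_zero] at h3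
    exact (le_max_left s 0).trans (le_fourierDim (le_max_right s 0) (h1.le.trans hS1) h3)
  exact ⟨hS0.trans_le hle, hle⟩
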